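/- For integers $n, d, D \ge 0$ let $\mathcal{P}(n,d,D)$ denote the set of all labelled simple planar graphs on the vertex set $\{1,2,\ldots,n\}$ all of whose vertex degrees lie between $d$ and $D$, inclusive. Let $D \in \{3,5\}$ be a constant. Then there exists a finite constant $\gamma_{D,D} > 0$ such that $$\left( \frac{|\mathcal{P}(2n,D,D)|}{(2n)!} \right)^{\frac{1}{2n}} \to \gamma_{D,D} \quad \text{as } n \to \infty.$$ -/

import Mathlib

open Filter Topology
open scoped Nat

/-- A rotation system (combinatorial embedding in an oriented closed surface) of a simple graph:
at every vertex, a cyclic order of all the darts (oriented edges) that leave this vertex.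
`rot d` is the dart that follows `d` in the cyclic order around the tail `d.fst`. -/
structure RotationSystem {V : Type*} (G : SimpleGraph V) where
  rot : Equiv.Perm G.Dart
  fst_rot : ∀ d : G.Dart, (rot d).fst = d.fst
  sameCycle_of_fst_eq : ∀ d e : G.Dart, d.fst = e.fst → rot.SameCycle d e

namespace RotationSystem

variable {V : Type*} {G : SimpleGraph V}

/-- Reversal of darts, as a permutation. -/
def revPerm (G : SimpleGraph V) : Equiv.Perm G.Dart where
  toFun d := d.symm
  invFun d := d.symm
  left_inv d := d.symm_symm
  right_inv d := d.symm_symm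

/-- Face tracing: run along `d` to its head, and leave by the dart that follows the reversal
of `d` in the cyclic order there. -/
def facePerm (R : RotationSystem G) : Equiv.Perm G.Dart := (revPerm G).trans R.rot

/-- The facial walks: the cycles (fixed points included) of the face-tracing permutation. -/
def FacialWalk (R : RotationSystem G) : Type _ :=
  Quotient (Equiv.Perm.SameCycle.setoid R.facePerm)

/-- The number of faces, every connected component being embedded in a surface of its own.
A component with an edge has its facial walks as faces; a component that is a single
vertex carries no dart, and its embedding in the sphere has exactly one face. -/
noncomputable def numFaces (R : RotationSystem G) : ℕ :=
  Nat.card R.FacialWalk + Nat.card {v : V // ∀ w, ¬ G.Adj v w}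

/-- The rotation system embeds every connected component in the sphere (Euler genus `0`).
A component of genus `g` has `#vertices - #edges + #faces = 2 - 2 * g`; the sum
of these equations over the components shows that all the genera vanish if and only if
`#vertices + #faces = #edges + 2 * #components`. -/
def IsSpherical (R : RotationSystem G) : Prop :=
  Nat.card V + R.numFaces = Nat.card G.edgeSet + 2 * Nat.card G.ConnectedComponent

end RotationSystem

/-- A finite simple graph is planar if it has a (combinatorial) embedding of genus `0`, that is,
if each of its connected components can be embedded in the sphere. -/
def IsPlanarGraph {V : Type*} [Finite V] (G : SimpleGraph V) : Prop :=
  ∃ R : RotationSystem G, R.IsSpherical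

open Classical in
/-- The set `𝒫(n, d, D)` of all labelled planar graphs on `n` labelled vertices
with all degrees between `d` and `D`, inclusive. -/
def boundedDegreePlanarGraphs (n d D : ℕ) : Set (SimpleGraph (Fin n)) :=
  {G | IsPlanarGraph G ∧ ∀ v, d ≤ G.degree v ∧ G.degree v ≤ D}

/-! Let `C n` and `R n` count the connected and all `D`-regular planar graphs on `n` labels. The
limit is first obtained for `C (2n) / (2n)!` by a Fekete argument and then transferred to `R`.

Supermultiplicativity (`choose_mul_numConnected_le`): take connected graphs on complementary label
sets, an edge `uv` of the first that is not a bridge and any edge `xy` of the second, and replace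
them by `ux`, `vy`. The result is connected, regular and planar, and four recorded vertices suffice
to undo the switch. Up to a factor `(n + m) ^ 4` this makes `C n / n!` supermultiplicative, and
`-log` of it is subadditive up to an `O(√n)` error.

Exponential upper bound (`numConnected_le`): contracting a spanning tree of an embedded graph turns
the darts into the corners of one polygon. Tree edges and remaining edges are two noncrossing
partial matchings of the corners, at most `4 ^ (D * n)` of each, and the labels of the vertices
contribute `n ^ n`.

Positivity: explicit solids with 4 and 6 vertices (cubic) or 12 and 22 vertices (quintic) combine,
by the same switch, to connected graphs of every large even order.

Transfer (`tendsto_root_of_recursion`): splitting off the component of a marked vertex bounds `R` by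
a convolution with `C`, so `R n / n!` has no larger exponential growth rate. For odd `D` all orders
are even, so the even indices determine the growth.

All topology is counting of cycles: multiplying a permutation by a transposition changes the number
of cycles by at most one, and joins two cycles when the transposed points lie in different ones.
This gives Euler's inequality (`DartModel.euler_le`), so that sphericity only requires enough faces.
-/

section QuotientCard

/-! ### Classes of an equivalence relation when two of them are merged. -/

variable {X : Type*}

/-- The coarsening of `r` that identifies the classes of `a` and `b`. -/
def mergeSetoid (r : Setoid X) (a b : X) : Setoid X where
  r x y := r x y ∨ ((r x a ∨ r x b) ∧ (r y a ∨ r y b))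
  iseqv :=
    { refl := fun x => Or.inl (r.refl x)
      symm := by
        rintro x y (h | ⟨h, h'⟩)
        · exact Or.inl (r.symm h)
        · exact Or.inr ⟨h', h⟩
      trans := by
        rintro x y z (h | ⟨h, h'⟩) (k | ⟨k, k'⟩)
        · exact Or.inl (r.trans h k)
        · exact Or.inr ⟨k.imp (r.trans h) (r.trans h), k'⟩
        · exact Or.inr ⟨h, h'.imp (r.trans (r.symm k)) (r.trans (r.symm k))⟩
        · exact Or.inr ⟨h, k'⟩ }

theorem le_mergeSetoid (r : Setoid X) (a b : X) : r ≤ mergeSetoid r a b :=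
  fun _ _ h => Or.inl h

theorem mergeSetoid_pair (r : Setoid X) (a b : X) : mergeSetoid r a b a b :=
  Or.inr ⟨Or.inl (r.refl a), Or.inr (r.refl b)⟩

theorem mergeSetoid_le {r s : Setoid X} {a b : X} (h : r ≤ s) (hab : s a b) :
    mergeSetoid r a b ≤ s := by
  have key : ∀ {x}, (r x a ∨ r x b) → s x a := by
    rintro x (hx | hx)
    · exact h hx
    · exact s.trans (h hx) (s.symm hab)
  rintro x y (hxy | ⟨hx, hy⟩)
  · exact h hxy
  · exact s.trans (key hx) (s.symm (key hy))

theorem card_quotient_le_of_le [Finite X] {r s : Setoid X} (h : r ≤ s) :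
    Nat.card (Quotient s) ≤ Nat.card (Quotient r) :=
  Nat.card_le_card_of_surjective (Quotient.map' id h) fun q =>
    q.inductionOn' fun x => ⟨Quotient.mk'' x, rfl⟩

/-- Only the classes of `a` and `b` can collapse. Sending the class of `b` to `none` and every other
class to its image is therefore injective. -/
theorem card_quotient_le_merge [Finite X] (r : Setoid X) (a b : X) :
    Nat.card (Quotient r) ≤ Nat.card (Quotient (mergeSetoid r a b)) + 1 := by
  classical
  rw [← Finite.card_option]
  refine Nat.card_le_card_of_injective
    (fun q : Quotient r => if q = Quotient.mk r b then none
      else some (Quotient.map' id (le_mergeSetoid r a b) q)) ?_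
  intro q q'
  induction q using Quotient.inductionOn with | h x => ?_
  induction q' using Quotient.inductionOn with | h y => ?_
  simp only
  intro h
  split_ifs at h with h1 h2 h2
  · rw [h1, h2]
  · have h3 : mergeSetoid r a b x y := Quotient.exact (Option.some.inj h)
    rw [Quotient.eq] at h1 h2 ⊢
    rcases h3 with h3 | ⟨h3, h4⟩
    · exact h3
    · exact r.trans (h3.resolve_right h1) (r.symm (h4.resolve_right h2))

theorem card_quotient_merge_lt [Finite X] {r : Setoid X} {a b : X} (hab : ¬ r a b) :
    Nat.card (Quotient (mergeSetoid r a b)) < Nat.card (Quotient r) := by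
  have hsurj : Function.Surjective (Quotient.map' id (le_mergeSetoid r a b) :
      Quotient r → Quotient (mergeSetoid r a b)) := fun q =>
    q.inductionOn' fun x => ⟨Quotient.mk'' x, rfl⟩
  refine lt_of_le_of_ne (card_quotient_le_of_le (le_mergeSetoid r a b)) fun heq => ?_
  have hinj := ((Nat.bijective_iff_surjective_and_card _).2 ⟨hsurj, heq.symm⟩).injective
  have : (Quotient.mk'' a : Quotient r) = Quotient.mk'' b :=
    hinj (Quotient.sound (mergeSetoid_pair r a b))
  exact hab (Quotient.exact this)

end QuotientCard

/-! ### Cycle counts, transpositions and involutions. -/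

namespace Equiv.Perm

variable {X : Type*}

/-- The number of cycles of a permutation, fixed points included. -/
noncomputable def numCycles (f : Perm X) : ℕ :=
  Nat.card (Quotient (SameCycle.setoid f))

theorem setoid_le_of_apply {f : Perm X} {r : Setoid X} (h : ∀ x, r x (f x)) :
    SameCycle.setoid f ≤ r := by
  have hpow : ∀ (n : ℕ) x, r x ((f ^ n) x) := by
    intro n
    induction n with
    | zero => intro x; exact r.refl x
    | succ n ih =>
      intro x
      rw [pow_succ', mul_apply]
      exact r.trans (ih x) (h _)
  rintro x y ⟨i, rfl⟩
  obtain ⟨n, rfl | rfl⟩ := i.eq_nat_or_neg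
  · exact_mod_cast hpow n x
  · have := hpow n ((f ^ (-(n : ℤ))) x)
    rw [zpow_neg, zpow_natCast, ← mul_apply, mul_inv_cancel, one_apply] at this
    rw [zpow_neg, zpow_natCast]
    exact r.symm this

theorem SameCycle.of_apply_mem [Finite X] {f : Perm X} {s : Set X} (hs : ∀ x ∈ s, f x ∈ s)
    {x y : X} (h : f.SameCycle x y) (hx : x ∈ s) : y ∈ s := by
  obtain ⟨n, rfl⟩ := h.exists_nat_pow_eq
  clear h
  induction n with
  | zero => exact hx
  | succ n ih => rw [pow_succ', mul_apply]; exact hs _ ih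

theorem sameCycle_apply_self (f : Perm X) (x : X) : f.SameCycle x (f x) :=
  sameCycle_apply_right.2 (SameCycle.refl f x)

theorem card_le_numCycles {Z : Type*} [Finite X] (f : Perm X) (g : X → Z) (hg : Function.Surjective g)
    (h : ∀ x, g (f x) = g x) : Nat.card Z ≤ numCycles f := by
  have hle : SameCycle.setoid f ≤ Setoid.ker g := setoid_le_of_apply fun x => (h x).symm
  refine Nat.card_le_card_of_surjective
    (Quotient.lift g fun x y hxy => hle hxy : Quotient (SameCycle.setoid f) → Z) ?_
  intro z
  obtain ⟨x, rfl⟩ := hg z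
  exact ⟨Quotient.mk _ x, rfl⟩

/-- The number of points moved by a permutation. -/
noncomputable def numMoved (f : Perm X) : ℕ := {x | f x ≠ x}.ncard

theorem numMoved_one : numMoved (1 : Perm X) = 0 := by simp [numMoved]

variable [DecidableEq X]

theorem setoid_mul_swap_le (f : Perm X) (a b : X) :
    SameCycle.setoid (f * swap a b) ≤ mergeSetoid (SameCycle.setoid f) a b := by
  apply setoid_le_of_apply
  intro x
  rw [mul_apply]
  by_cases hxa : x = a
  · subst hxa
    rw [swap_apply_left]
    exact Or.inr ⟨Or.inl (SameCycle.refl _ _), Or.inr (sameCycle_apply_left.2 (SameCycle.refl _ _))⟩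
  by_cases hxb : x = b
  · subst hxb
    rw [swap_apply_right]
    exact Or.inr ⟨Or.inr (SameCycle.refl _ _), Or.inl (sameCycle_apply_left.2 (SameCycle.refl _ _))⟩
  rw [swap_apply_of_ne_of_ne hxa hxb]
  exact Or.inl (sameCycle_apply_self f x)

/-- The new permutation sends `a` to `f b` and then follows the old cycle of `b`, which avoids `a`,
until it arrives at `b`. Formally, if it never reached `b`, the points common to the old cycle of
`b` and the new cycle of `a` would be closed under `f`, hence contain `b`. -/
theorem sameCycle_mul_swap [Finite X] {f : Perm X} {a b : X} (hab : ¬ f.SameCycle a b) :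
    (f * swap a b).SameCycle a b := by
  by_contra hg
  set g := f * swap a b with hgdef
  have hga : g a = f b := by rw [hgdef, mul_apply, swap_apply_left]
  have hg' : ∀ x, x ≠ a → x ≠ b → g x = f x := fun x h1 h2 => by
    rw [hgdef, mul_apply, swap_apply_of_ne_of_ne h1 h2]
  have hmem : b ∈ {x | f.SameCycle x b ∧ g.SameCycle a x} := by
    refine SameCycle.of_apply_mem (f := f) (x := f b) ?_
      (sameCycle_apply_left.2 (SameCycle.refl _ _)) ?_
    · rintro x ⟨hx, hx'⟩
      refine ⟨sameCycle_apply_left.2 hx, ?_⟩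
      have hxa : x ≠ a := by rintro rfl; exact hab hx
      have hxb : x ≠ b := by rintro rfl; exact hg hx'
      rw [← hg' x hxa hxb]
      exact sameCycle_apply_right.2 hx'
    · exact ⟨sameCycle_apply_left.2 (SameCycle.refl _ _), by
        rw [← hga]; exact sameCycle_apply_self _ _⟩
  exact hg hmem.2

theorem merge_le_setoid_mul_swap [Finite X] {f : Perm X} {a b : X} (hab : ¬ f.SameCycle a b) :
    mergeSetoid (SameCycle.setoid f) a b ≤ SameCycle.setoid (f * swap a b) := by
  have hg := sameCycle_mul_swap hab
  refine mergeSetoid_le (setoid_le_of_apply fun x => ?_) hg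
  change (f * swap a b).SameCycle x (f x)
  by_cases hxa : x = a
  · subst hxa
    refine hg.trans ?_
    have := sameCycle_apply_self (f * swap x b) b
    rwa [mul_apply, swap_apply_right] at this
  by_cases hxb : x = b
  · subst hxb
    refine hg.symm.trans ?_
    have := sameCycle_apply_self (f * swap a x) a
    rwa [mul_apply, swap_apply_left] at this
  have := sameCycle_apply_self (f * swap a b) x
  rwa [mul_apply, swap_apply_of_ne_of_ne hxa hxb] at this

theorem swap_mul_apply_of_involutive {f : Perm X} (hf : ∀ x, f (f x) = x) (a x : X) :
    (swap a (f a) * f) x = if x = a ∨ x = f a then x else f x := by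
  rw [mul_apply]
  by_cases hxa : x = a
  · subst hxa; simp
  by_cases hxb : x = f a
  · subst hxb; simp [hf]
  rw [if_neg (by tauto), swap_apply_of_ne_of_ne]
  · intro h; exact hxb (by rw [← h, hf])
  · intro h; exact hxa (f.injective h)

theorem swap_mul_involutive {f : Perm X} (hf : ∀ x, f (f x) = x) (a : X) (x : X) :
    (swap a (f a) * f) ((swap a (f a) * f) x) = x := by
  rw [swap_mul_apply_of_involutive hf a x]
  split_ifs with h
  · rw [swap_mul_apply_of_involutive hf, if_pos h]
  · rw [swap_mul_apply_of_involutive hf, if_neg, hf]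
    rintro (h' | h')
    · exact h (Or.inr (by rw [← h', hf]))
    · exact h (Or.inl (f.injective h'))

theorem swap_mul_mul_swap {f : Perm X} (hf : ∀ x, f (f x) = x) (a : X) :
    swap a (f a) * f * swap a (f a) = f := by
  ext x
  rw [mul_apply, swap_mul_apply_of_involutive hf]
  by_cases hxa : x = a
  · subst hxa; simp
  by_cases hxb : x = f a
  · subst hxb; simp [hf]
  rw [swap_apply_of_ne_of_ne hxa hxb, if_neg (by tauto)]

variable [Finite X]

theorem numCycles_le_mul_swap (f : Perm X) (a b : X) :
    numCycles f ≤ numCycles (f * swap a b) + 1 :=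
  (card_quotient_le_merge _ a b).trans
    (Nat.add_le_add_right (card_quotient_le_of_le (setoid_mul_swap_le f a b)) 1)

theorem numCycles_mul_swap_le (f : Perm X) (a b : X) :
    numCycles (f * swap a b) ≤ numCycles f + 1 := by
  simpa [mul_assoc] using numCycles_le_mul_swap (f * swap a b) a b

theorem numCycles_mul_swap_of_not_sameCycle {f : Perm X} {a b : X} (hab : ¬ f.SameCycle a b) :
    numCycles (f * swap a b) + 1 = numCycles f := by
  refine le_antisymm ?_ (numCycles_le_mul_swap f a b)
  exact (Nat.add_le_add_right
    (card_quotient_le_of_le (merge_le_setoid_mul_swap hab)) 1).trans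
    (card_quotient_merge_lt (r := SameCycle.setoid f) hab)

theorem numMoved_mul_swap {f : Perm X} {a b : X} (ha : f a = a) (hb : f b = b) (hab : a ≠ b) :
    numMoved (f * swap a b) = numMoved f + 2 := by
  have : {x | (f * swap a b) x ≠ x} = insert a (insert b {x | f x ≠ x}) := by
    ext x
    by_cases hxa : x = a
    · subst hxa; simp [hb, hab.symm]
    by_cases hxb : x = b
    · subst hxb; simp [ha, hab]
    simp [swap_apply_of_ne_of_ne, hxa, hxb]
  rw [numMoved, this, Set.ncard_insert_of_notMem, Set.ncard_insert_of_notMem, numMoved]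
  · simp [hb]
  · simp [ha, hab]

theorem numMoved_swap_mul {f : Perm X} (hf : ∀ x, f (f x) = x) {a : X} (ha : f a ≠ a) :
    numMoved f = numMoved (swap a (f a) * f) + 2 := by
  conv_lhs => rw [← swap_mul_mul_swap hf a]
  apply numMoved_mul_swap _ _ ha.symm
  · rw [swap_mul_apply_of_involutive hf, if_pos (Or.inl rfl)]
  · rw [swap_mul_apply_of_involutive hf, if_pos (Or.inr rfl)]

/-- Every involution is obtained from the identity by multiplying with transpositions of fixed
points. -/
theorem involution_induction {P : Perm X → Prop} (one : P 1)
    (step : ∀ (f : Perm X) (a b : X), (∀ x, f (f x) = x) → f a = a → f b = b → a ≠ b →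
      P f → P (f * swap a b)) (f : Perm X) (hf : ∀ x, f (f x) = x) : P f := by
  induction h : numMoved f using Nat.strong_induction_on generalizing f with
  | _ n ih =>
    by_cases hone : f = 1
    · rwa [hone]
    obtain ⟨a, ha⟩ : ∃ a, f a ≠ a := by
      by_contra! hcon
      exact hone (Equiv.ext hcon)
    have hlt := numMoved_swap_mul hf ha
    rw [← swap_mul_mul_swap hf a]
    refine step _ a (f a) (swap_mul_involutive hf a) ?_ ?_ ha.symm
      (ih _ (by omega) _ (swap_mul_involutive hf a) rfl)
    · rw [swap_mul_apply_of_involutive hf, if_pos (Or.inl rfl)]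
    · rw [swap_mul_apply_of_involutive hf, if_pos (Or.inr rfl)]

theorem numCycles_mul_involution_le (s f : Perm X) (hf : ∀ x, f (f x) = x) :
    2 * numCycles (s * f) ≤ 2 * numCycles s + numMoved f := by
  revert hf
  refine involution_induction (P := fun f => 2 * numCycles (s * f) ≤ 2 * numCycles s + numMoved f)
    (by simp) (fun f a b _ ha hb hab ih => ?_) f
  have := numCycles_mul_swap_le (s * f) a b
  rw [numMoved_mul_swap ha hb hab, ← mul_assoc]
  omega

/-- The genus of the hypermap of `s` and an involution `f` is nonnegative. -/
theorem exists_setoid_genus_le (s f : Perm X) (hf : ∀ x, f (f x) = x) :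
    ∃ r : Setoid X, (∀ x, r x (s x)) ∧ (∀ x, r x (f x)) ∧
      2 * numCycles s + 2 * numCycles (s * f) ≤ numMoved f + 4 * Nat.card (Quotient r) := by
  revert hf
  refine involution_induction (P := fun f => ∃ r : Setoid X, (∀ x, r x (s x)) ∧ (∀ x, r x (f x)) ∧
      2 * numCycles s + 2 * numCycles (s * f) ≤ numMoved f + 4 * Nat.card (Quotient r))
    ⟨SameCycle.setoid s, sameCycle_apply_self s, fun x => SameCycle.refl _ _, ?_⟩
    (fun f a b _ ha hb hab ih => ?_) f
  · rw [mul_one, numMoved_one, numCycles]; omega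
  obtain ⟨r, hs, hf, hle⟩ := ih
  have happ : ∀ {t : Setoid X}, (∀ x, t x (f x)) → t a b → ∀ x, t x ((f * swap a b) x) := by
    intro t ht htab x
    rw [mul_apply]
    by_cases hxa : x = a
    · subst hxa; rw [swap_apply_left, hb]; exact htab
    by_cases hxb : x = b
    · subst hxb; rw [swap_apply_right, ha]; exact t.symm htab
    rw [swap_apply_of_ne_of_ne hxa hxb]; exact ht x
  rw [numMoved_mul_swap ha hb hab, ← mul_assoc]
  -- Both bounds are tight. If `a`, `b` are already related, the cycle count rises by at most 1,
  -- paid for by the two newly moved points. Otherwise two cycles of `s * f` merge, which offsets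
  -- the loss of one class.
  by_cases hr : r a b
  · have := numCycles_mul_swap_le (s * f) a b
    exact ⟨r, hs, happ hf hr, by omega⟩
  · have hle' : SameCycle.setoid (s * f) ≤ r := setoid_le_of_apply fun x =>
      r.trans (hf x) (hs (f x))
    have h1 := numCycles_mul_swap_of_not_sameCycle (f := s * f) fun h => hr (hle' h)
    have h2 := card_quotient_le_merge r a b
    exact ⟨mergeSetoid r a b, fun x => le_mergeSetoid r a b (hs x),
      happ (fun x => le_mergeSetoid r a b (hf x)) (mergeSetoid_pair r a b), by omega⟩

/-- If `s` and the involution `f` generate a transitive group, then part of `f` connects all the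
cycles of `s` into a single one, in a tree-like way. -/
theorem exists_tree_involution [Nonempty X] (s f : Perm X) (hf : ∀ x, f (f x) = x)
    (htrans : ∀ r : Setoid X, (∀ x, r x (s x)) → (∀ x, r x (f x)) → ∀ x y, r x y) :
    ∃ t : Perm X, (∀ x, t (t x) = x) ∧ (∀ x, t x = x ∨ t x = f x) ∧ numCycles (s * t) = 1 ∧
      2 * numCycles s = numMoved t + 2 := by
  -- A spanning tree grown greedily: while `s * t` has several cycles, transitivity yields a 2-cycle
  -- of `f` between two of them, and adding it to `t` merges these two. Here `n` counts the mergers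
  -- still to be made.
  have key : ∀ n, ∀ t : Perm X, numCycles (s * t) = n + 1 → (∀ x, t (t x) = x) →
      (∀ x, t x = x ∨ t x = f x) → SameCycle.setoid s ≤ SameCycle.setoid (s * t) →
      (∀ x, (s * t).SameCycle x (t x)) → 2 * numCycles s = numMoved t + 2 * numCycles (s * t) →
      ∃ t : Perm X, (∀ x, t (t x) = x) ∧ (∀ x, t x = x ∨ t x = f x) ∧ numCycles (s * t) = 1 ∧
        2 * numCycles s = numMoved t + 2 := by
    intro n
    induction n with
    | zero =>
      intro t h1 h2 h3 _ _ h6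
      exact ⟨t, h2, h3, h1, by omega⟩
    | succ n ih =>
      intro t h1 h2 h3 h4 h5 h6
      obtain ⟨x, hx⟩ : ∃ x, ¬ (s * t).SameCycle x (f x) := by
        by_contra! hcon
        have hall := htrans (SameCycle.setoid (s * t))
          (fun x => h4 (sameCycle_apply_self s x)) hcon
        have : Subsingleton (Quotient (SameCycle.setoid (s * t))) :=
          ⟨fun p q => Quotient.inductionOn₂ p q fun x y => Quotient.sound (hall x y)⟩
        have := Finite.card_le_one_iff_subsingleton.2 this
        rw [numCycles] at h1
        omega
      have hfx : x ≠ f x := fun h => hx (h ▸ SameCycle.refl _ _)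
      have htx : t x = x := (h3 x).resolve_right fun h => hx (h ▸ h5 x)
      have htfx : t (f x) = f x := (h3 (f x)).resolve_right fun h => hx (by
        rw [hf] at h
        have := h5 (f x)
        rw [h] at this
        exact this.symm)
      have hcyc := numCycles_mul_swap_of_not_sameCycle hx
      have hle := merge_le_setoid_mul_swap hx
      have hle' : SameCycle.setoid (s * t) ≤ SameCycle.setoid (s * t * swap x (f x)) :=
        (le_mergeSetoid _ _ _).trans hle
      have happ : ∀ y, (t * swap x (f x)) y = if y = x then f x else if y = f x then x else t y := by
        intro y
        rw [mul_apply]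
        split_ifs with ha hb
        · rw [ha, swap_apply_left, htfx]
        · rw [hb, swap_apply_right, htx]
        · rw [swap_apply_of_ne_of_ne ha hb]
      rw [mul_assoc] at hcyc hle hle'
      refine ih (t * swap x (f x)) (by omega) ?_ ?_ (h4.trans hle') ?_ ?_
      · intro y
        rw [happ y]
        split_ifs with ha hb
        · rw [happ, if_neg hfx.symm, if_pos rfl, ha]
        · rw [happ, if_pos rfl, hb]
        · rw [happ, if_neg, if_neg, h2]
          · intro h; exact hb (by rw [← h2 y, h, htfx])
          · intro h; exact ha (by rw [← h2 y, h, htx])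
      · intro y
        rw [happ y]
        split_ifs with ha hb
        · exact Or.inr (by rw [ha])
        · exact Or.inr (by rw [hb, hf])
        · exact h3 y
      · intro y
        rw [happ y]
        split_ifs with ha hb
        · rw [ha]; exact hle (mergeSetoid_pair _ _ _)
        · rw [hb]; exact (hle (mergeSetoid_pair _ _ _)).symm
        · exact hle' (h5 y)
      · rw [numMoved_mul_swap htx htfx hfx]; omega
  obtain ⟨n, hn⟩ : ∃ n, numCycles s = n + 1 := by
    have : 0 < numCycles s := by
      rw [numCycles]
      exact Nat.card_pos_iff.2 ⟨⟨Quotient.mk _ (Classical.arbitrary X)⟩, inferInstance⟩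
    exact ⟨numCycles s - 1, by omega⟩
  exact key n 1 (by rwa [mul_one]) (fun _ => rfl) (fun _ => Or.inl rfl) (by rw [mul_one])
    (fun _ => SameCycle.refl _ _) (by rw [numMoved_one, mul_one]; omega)

end Equiv.Perm

namespace Equiv.Perm

theorem numCycles_le_of_semiconj {X Y : Type*} [Finite Y] {f : Perm X} {g : Perm Y} (h : Y → X)
    (hh : Function.Surjective h) (hfg : ∀ y, h (g y) = f (h y)) : numCycles f ≤ numCycles g :=
  card_le_numCycles g (fun y => (Quotient.mk (SameCycle.setoid f) (h y)))
    (Quotient.mk_surjective.comp hh) fun y => Quotient.sound (by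
      rw [hfg]; exact (sameCycle_apply_self f _).symm)

theorem numCycles_eq_of_semiconj {X Y : Type*} [Finite X] {f : Perm X} {g : Perm Y} (e : Y ≃ X)
    (hfg : ∀ y, e (g y) = f (e y)) : numCycles f = numCycles g := by
  have := Finite.of_equiv X e.symm
  refine le_antisymm (numCycles_le_of_semiconj e e.surjective hfg)
    (numCycles_le_of_semiconj e.symm e.symm.surjective fun x => ?_)
  rw [Equiv.symm_apply_eq, hfg, Equiv.apply_symm_apply]

end Equiv.Perm

/-! ### Dart models, Euler's inequality and restriction to components. -/

open Equiv.Perm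

/-- A presentation of a rotation system of a graph without isolated vertices, the darts being
the elements of an arbitrary type. -/
structure DartModel {V : Type*} (G : SimpleGraph V) (X : Type*) where
  rot : Equiv.Perm X
  rev : Equiv.Perm X
  tail : X → V
  rev_rev : ∀ x, rev (rev x) = x
  tail_eq_iff : ∀ x y, tail x = tail y ↔ rot.SameCycle x y
  tail_surjective : Function.Surjective tail
  adj_iff : ∀ a b, G.Adj a b ↔ ∃ x, tail x = a ∧ tail (rev x) = b
  ext_tail : ∀ x y, tail x = tail y → tail (rev x) = tail (rev y) → x = y

namespace DartModel

variable {V W X : Type*} {G : SimpleGraph V} (M : DartModel G X)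

/-- The number of cycles of the face-tracing permutation. -/
noncomputable def numFaces : ℕ := numCycles (M.rot * M.rev)

/-- Euler genus zero. -/
def Spherical : Prop :=
  -- This is the Euler relation doubled, since `X` counts every edge twice.
  2 * Nat.card V + 2 * M.numFaces = Nat.card X + 4 * Nat.card G.ConnectedComponent

theorem adj_tail (x : X) : G.Adj (M.tail x) (M.tail (M.rev x)) :=
  (M.adj_iff _ _).2 ⟨x, rfl, rfl⟩

theorem tail_rot (x : X) : M.tail (M.rot x) = M.tail x :=
  (M.tail_eq_iff _ _).2 (sameCycle_apply_self _ _).symm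

theorem rev_ne (x : X) : M.rev x ≠ x := fun h => (M.adj_tail x).ne (by rw [h])

theorem numCycles_rot : numCycles M.rot = Nat.card V :=
  Nat.card_congr (Equiv.ofBijective
    (Quotient.lift M.tail fun x y h => (M.tail_eq_iff x y).2 h :
      Quotient (SameCycle.setoid M.rot) → V)
    ⟨fun p q => Quotient.inductionOn₂ p q fun x y h => Quotient.sound ((M.tail_eq_iff x y).1 h),
      fun v => by
        obtain ⟨x, rfl⟩ := M.tail_surjective v
        exact ⟨Quotient.mk _ x, rfl⟩⟩)

theorem numMoved_rev : numMoved M.rev = Nat.card X := by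
  have : {x | M.rev x ≠ x} = Set.univ := Set.eq_univ_of_forall M.rev_ne
  rw [numMoved, this, Set.ncard_univ]

theorem exists_adj (M : DartModel G X) (v : V) : ∃ w, G.Adj v w := by
  obtain ⟨x, rfl⟩ := M.tail_surjective v
  exact ⟨_, M.adj_tail x⟩

theorem setoid_of_reachable {r : Setoid X} (hrot : ∀ x, r x (M.rot x))
    (hrev : ∀ x, r x (M.rev x)) {x y : X} (h : G.Reachable (M.tail x) (M.tail y)) : r x y := by
  have htail : ∀ {x y}, M.tail x = M.tail y → r x y := fun {x y} hxy =>
    setoid_le_of_apply hrot ((M.tail_eq_iff x y).1 hxy)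
  have key : ∀ {a b : V}, G.Walk a b → ∀ x y, M.tail x = a → M.tail y = b → r x y := by
    intro a b p
    induction p with
    | nil => intro x y hx hy; exact htail (hx.trans hy.symm)
    | cons hadj p ih =>
      intro x y hx hy
      obtain ⟨z, hz, hz'⟩ := (M.adj_iff _ _).1 hadj
      exact r.trans (htail (hx.trans hz.symm)) (r.trans (hrev z) (ih _ _ hz' hy))
  exact h.elim fun p => key p x y rfl rfl

/-- The relation from `exists_setoid_genus_le` is closed under rotation and reversal, so it relates
all darts of one component and has at most as many classes as there are components. -/
theorem euler_le [Finite V] [Finite X] :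
    2 * Nat.card V + 2 * M.numFaces ≤ Nat.card X + 4 * Nat.card G.ConnectedComponent := by
  classical
  obtain ⟨r, hrot, hrev, hle⟩ := exists_setoid_genus_le M.rot M.rev M.rev_rev
  rw [M.numCycles_rot, M.numMoved_rev] at hle
  have : Nat.card (Quotient r) ≤ Nat.card G.ConnectedComponent := by
    refine Nat.card_le_card_of_injective
      (fun q : Quotient r => G.connectedComponentMk (M.tail q.out)) fun p q h => ?_
    have := M.setoid_of_reachable hrot hrev (SimpleGraph.ConnectedComponent.exact h)
    rw [← Quotient.out_eq p, ← Quotient.out_eq q]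
    exact Quotient.sound this
  rw [numFaces]
  omega

theorem spherical_of_le [Finite V] [Finite X]
    (h : Nat.card X + 4 * Nat.card G.ConnectedComponent ≤ 2 * Nat.card V + 2 * M.numFaces) :
    M.Spherical := le_antisymm M.euler_le h

/-- The darts of the model are the darts of the graph. -/
noncomputable def dartEquiv : X ≃ G.Dart :=
  Equiv.ofBijective (fun x => ⟨(M.tail x, M.tail (M.rev x)), M.adj_tail x⟩)
    ⟨fun x y h => by
      have h' := congrArg SimpleGraph.Dart.toProd h
      exact M.ext_tail x y (congrArg Prod.fst h') (congrArg Prod.snd h'),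
    fun d => by
      obtain ⟨x, hx, hx'⟩ := (M.adj_iff _ _).1 d.adj
      exact ⟨x, SimpleGraph.Dart.ext _ _ (Prod.ext hx hx')⟩⟩

theorem dartEquiv_fst (x : X) : (M.dartEquiv x).fst = M.tail x := rfl

theorem dartEquiv_rev (x : X) : M.dartEquiv (M.rev x) = (M.dartEquiv x).symm := by
  apply SimpleGraph.Dart.ext
  change (M.tail (M.rev x), M.tail (M.rev (M.rev x))) = (M.tail (M.rev x), M.tail x)
  rw [M.rev_rev]

theorem _root_.SimpleGraph.card_dart [Finite V] (G : SimpleGraph V) :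
    Nat.card G.Dart = 2 * Nat.card G.edgeSet := by
  classical
  have := Fintype.ofFinite V
  rw [Nat.card_eq_fintype_card, G.dart_card_eq_twice_card_edges, Nat.card_eq_fintype_card,
    SimpleGraph.edgeFinset_card]

theorem card_isolated (h : ∀ v, ∃ w, G.Adj v w) :
    Nat.card {v : V // ∀ w, ¬ G.Adj v w} = 0 := by
  have : IsEmpty {v : V // ∀ w, ¬ G.Adj v w} := ⟨fun v => (h v.1).elim fun w hw => v.2 w hw⟩
  exact Nat.card_of_isEmpty

/-- A rotation system as a model. -/
def ofRotationSystem (R : RotationSystem G) (h : ∀ v, ∃ w, G.Adj v w) :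
    DartModel G G.Dart where
  rot := R.rot
  rev := RotationSystem.revPerm G
  tail d := d.fst
  rev_rev d := d.symm_symm
  tail_eq_iff d e := ⟨R.sameCycle_of_fst_eq d e, fun hde => by
    have : SameCycle.setoid R.rot ≤ Setoid.ker (fun d : G.Dart => d.fst) :=
      setoid_le_of_apply fun d => (R.fst_rot d).symm
    exact this hde⟩
  tail_surjective v := (h v).elim fun w hw => ⟨⟨(v, w), hw⟩, rfl⟩
  adj_iff a b := ⟨fun hab => ⟨⟨(a, b), hab⟩, rfl, rfl⟩, by rintro ⟨d, rfl, rfl⟩; exact d.adj⟩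
  ext_tail d e h1 h2 := SimpleGraph.Dart.ext _ _ (Prod.ext h1 h2)

theorem ofRotationSystem_spherical [Finite V] {R : RotationSystem G} (h : ∀ v, ∃ w, G.Adj v w)
    (hR : R.IsSpherical) : (ofRotationSystem R h).Spherical := by
  have hF : (ofRotationSystem R h).numFaces = Nat.card R.FacialWalk := rfl
  rw [RotationSystem.IsSpherical, RotationSystem.numFaces, card_isolated h] at hR
  rw [Spherical, hF, G.card_dart]
  omega

theorem isPlanarGraph [Finite V] [Finite X] (hM : M.Spherical) : IsPlanarGraph G := by
  let R : RotationSystem G :=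
    { rot := M.dartEquiv.permCongr M.rot
      fst_rot := fun d => by
        rw [Equiv.permCongr_apply, dartEquiv_fst, M.tail_rot, ← dartEquiv_fst,
          Equiv.apply_symm_apply]
      sameCycle_of_fst_eq := fun d e h => by
        obtain ⟨x, rfl⟩ := M.dartEquiv.surjective d
        obtain ⟨y, rfl⟩ := M.dartEquiv.surjective e
        have hle : SameCycle.setoid M.rot ≤ Setoid.comap M.dartEquiv
            (SameCycle.setoid (M.dartEquiv.permCongr M.rot)) := setoid_le_of_apply fun x => by
          have := sameCycle_apply_self (M.dartEquiv.permCongr M.rot) (M.dartEquiv x)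
          rwa [Equiv.permCongr_apply, Equiv.symm_apply_apply] at this
        exact hle ((M.tail_eq_iff x y).1 h) }
  refine ⟨R, ?_⟩
  have hF : Nat.card R.FacialWalk = M.numFaces := by
    refine (numCycles_eq_of_semiconj M.dartEquiv.symm fun d => ?_).symm
    rw [Equiv.symm_apply_eq]
    change M.dartEquiv (M.rot (M.dartEquiv.symm d.symm)) = M.dartEquiv (M.rot (M.rev _))
    congr 2
    rw [Equiv.symm_apply_eq, dartEquiv_rev, Equiv.apply_symm_apply]
  rw [Spherical, Nat.card_congr M.dartEquiv, G.card_dart] at hM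
  rw [RotationSystem.IsSpherical, RotationSystem.numFaces, hF, card_isolated M.exists_adj]
  omega

/-- Transport along a bijection of the vertices. -/
def mapIso {H : SimpleGraph W} (e : G ≃g H) : DartModel H X where
  rot := M.rot
  rev := M.rev
  tail x := e (M.tail x)
  rev_rev := M.rev_rev
  tail_eq_iff x y := e.injective.eq_iff.trans (M.tail_eq_iff x y)
  tail_surjective := e.surjective.comp M.tail_surjective
  adj_iff a b := by
    rw [← e.symm.map_adj_iff, M.adj_iff]
    simp only [RelIso.eq_symm_apply, RelIso.symm_apply_eq, eq_comm]
  ext_tail x y h1 h2 := M.ext_tail x y (e.injective h1) (e.injective h2)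

theorem mapIso_spherical {H : SimpleGraph W} (e : G ≃g H) (h : M.Spherical) :
    (M.mapIso e).Spherical := by
  have hF : (M.mapIso e).numFaces = M.numFaces := rfl
  rw [Spherical] at h ⊢
  rw [hF, ← Nat.card_congr e.toEquiv, ← Nat.card_congr e.connectedComponentEquiv, h]

/-- The part of a model on a union of connected components. -/
def restrict (S : Set V) (hS : ∀ a b, G.Adj a b → (a ∈ S ↔ b ∈ S)) :
    DartModel (G.induce S) {x // M.tail x ∈ S} where
  rot := M.rot.subtypePerm fun x => by rw [M.tail_rot]
  rev := M.rev.subtypePerm fun x => (hS _ _ (M.adj_tail x)).symm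
  tail x := ⟨M.tail x.1, x.2⟩
  rev_rev x := Subtype.ext (M.rev_rev x.1)
  tail_eq_iff x y := by
    rw [sameCycle_subtypePerm, ← M.tail_eq_iff, Subtype.mk.injEq]
  tail_surjective v := by
    obtain ⟨x, hx⟩ := M.tail_surjective v.1
    exact ⟨⟨x, hx ▸ v.2⟩, Subtype.ext hx⟩
  adj_iff a b := by
    rw [SimpleGraph.comap_adj, Function.Embedding.subtype_apply, Function.Embedding.subtype_apply,
      M.adj_iff]
    constructor
    · rintro ⟨x, hx, hx'⟩
      exact ⟨⟨x, hx ▸ a.2⟩, Subtype.ext hx, Subtype.ext hx'⟩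
    · rintro ⟨x, hx, hx'⟩
      exact ⟨x.1, congrArg Subtype.val hx, congrArg Subtype.val hx'⟩
  ext_tail x y h1 h2 := Subtype.ext
    (M.ext_tail _ _ (congrArg Subtype.val h1) (congrArg Subtype.val h2))

theorem _root_.SimpleGraph.Reachable.induce_of_closed {S : Set V}
    (hS : ∀ a b, G.Adj a b → (a ∈ S ↔ b ∈ S)) {a b : V} (h : G.Reachable a b) (ha : a ∈ S) :
    ∃ hb : b ∈ S, (G.induce S).Reachable ⟨a, ha⟩ ⟨b, hb⟩ := by
  obtain ⟨p⟩ := h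
  induction p with
  | nil => exact ⟨ha, SimpleGraph.Reachable.refl _⟩
  | cons hadj p ih =>
    obtain ⟨hb, hr⟩ := ih ((hS _ _ hadj).1 ha)
    refine ⟨hb, SimpleGraph.Reachable.trans (SimpleGraph.Adj.reachable ?_) hr⟩
    exact hadj

theorem card_connectedComponent_induce_add_le [Finite V] (G : SimpleGraph V) (S : Set V)
    (hS : ∀ a b, G.Adj a b → (a ∈ S ↔ b ∈ S)) :
    Nat.card (G.induce S).ConnectedComponent + Nat.card (G.induce Sᶜ).ConnectedComponent ≤
      Nat.card G.ConnectedComponent := by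
  rw [← Nat.card_sum]
  have hS' : ∀ a b, G.Adj a b → (a ∈ Sᶜ ↔ b ∈ Sᶜ) := fun a b h => not_congr (hS a b h)
  refine Nat.card_le_card_of_injective (Sum.elim
    (SimpleGraph.ConnectedComponent.map (SimpleGraph.Embedding.induce (G := G) S).toHom)
    (SimpleGraph.ConnectedComponent.map (SimpleGraph.Embedding.induce (G := G) Sᶜ).toHom)) ?_
  have key : ∀ {a b : V}, G.connectedComponentMk a = G.connectedComponentMk b → a ∈ S → b ∈ S :=
    fun h ha => ((SimpleGraph.ConnectedComponent.exact h).induce_of_closed hS ha).1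
  rintro (p | p) (q | q) <;> induction p using SimpleGraph.ConnectedComponent.ind <;>
    induction q using SimpleGraph.ConnectedComponent.ind <;> rename_i a b <;> intro h <;>
    simp only [Sum.elim_inl, Sum.elim_inr, SimpleGraph.ConnectedComponent.map_mk] at h
  · obtain ⟨_, hr⟩ := (SimpleGraph.ConnectedComponent.exact h).induce_of_closed hS a.2
    exact congrArg Sum.inl (SimpleGraph.ConnectedComponent.sound hr)
  · exact absurd (key h a.2) b.2
  · exact absurd (key h.symm b.2) a.2
  · obtain ⟨_, hr⟩ := (SimpleGraph.ConnectedComponent.exact h).induce_of_closed hS' a.2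
    exact congrArg Sum.inr (SimpleGraph.ConnectedComponent.sound hr)

theorem numFaces_le_restrict [Finite X] (S : Set V) (hS : ∀ a b, G.Adj a b → (a ∈ S ↔ b ∈ S)) :
    M.numFaces ≤ (M.restrict S hS).numFaces +
      (M.restrict Sᶜ fun a b h => not_congr (hS a b h)).numFaces := by
  have hS' : ∀ a b, G.Adj a b → (a ∈ Sᶜ ↔ b ∈ Sᶜ) := fun a b h => not_congr (hS a b h)
  have hlift : ∀ (T : Set V) (hT : ∀ a b, G.Adj a b → (a ∈ T ↔ b ∈ T)),
      SameCycle.setoid ((M.restrict T hT).rot * (M.restrict T hT).rev) ≤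
        Setoid.comap Subtype.val (SameCycle.setoid (M.rot * M.rev)) := fun T hT =>
    setoid_le_of_apply fun x => sameCycle_apply_self (M.rot * M.rev) x.1
  rw [numFaces, numFaces, numFaces, numCycles, numCycles, numCycles, ← Nat.card_sum]
  refine Nat.card_le_card_of_surjective (Sum.elim (Quotient.map' Subtype.val (hlift S hS))
    (Quotient.map' Subtype.val (hlift Sᶜ hS'))) fun q => ?_
  induction q using Quotient.inductionOn with | h x => ?_
  by_cases hx : M.tail x ∈ S
  · exact ⟨Sum.inl (Quotient.mk'' ⟨x, hx⟩), rfl⟩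
  · exact ⟨Sum.inr (Quotient.mk'' ⟨x, hx⟩), rfl⟩

/-- Euler's inequality holds on `S` and on its complement, and the two inequalities add up to an
equality for the whole model. Hence neither can be strict. -/
theorem restrict_spherical [Finite V] [Finite X] (hM : M.Spherical) (S : Set V)
    (hS : ∀ a b, G.Adj a b → (a ∈ S ↔ b ∈ S)) : (M.restrict S hS).Spherical := by
  classical
  have h1 := (M.restrict S hS).euler_le
  have h2 := (M.restrict Sᶜ fun a b h => not_congr (hS a b h)).euler_le
  have h3 := M.numFaces_le_restrict S hS
  have h4 := card_connectedComponent_induce_add_le G S hS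
  have h5 : Nat.card X = Nat.card {x // M.tail x ∈ S} + Nat.card {x // M.tail x ∈ Sᶜ} := by
    rw [← Nat.card_sum]
    exact Nat.card_congr (Equiv.sumCompl fun x => M.tail x ∈ S).symm
  have h6 : Nat.card V = Nat.card S + Nat.card (Sᶜ : Set V) := by
    rw [← Nat.card_sum]
    exact Nat.card_congr (Equiv.sumCompl fun x => x ∈ S).symm
  rw [Spherical] at hM ⊢
  omega

end DartModel

/-! ### Switching a pair of edges in a graph. -/

namespace SimpleGraph

variable {V : Type*}

/-- Replace the edges `uv`, `xy` by `ux`, `vy`. -/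
def switchEdges (G : SimpleGraph V) (u v x y : V) : SimpleGraph V where
  Adj a b := (G.Adj a b ∧ s(a, b) ≠ s(u, v) ∧ s(a, b) ≠ s(x, y)) ∨
    (a ≠ b ∧ (s(a, b) = s(u, x) ∨ s(a, b) = s(v, y)))
  symm := ⟨fun a b h => by rwa [G.adj_comm, Sym2.eq_swap, ne_comm (a := b)]⟩
  loopless := ⟨fun a h => by simp at h⟩

theorem switchEdges_adj (G : SimpleGraph V) (u v x y a b : V) :
    (G.switchEdges u v x y).Adj a b ↔ (G.Adj a b ∧ s(a, b) ≠ s(u, v) ∧ s(a, b) ≠ s(x, y)) ∨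
    (a ≠ b ∧ (s(a, b) = s(u, x) ∨ s(a, b) = s(v, y))) := Iff.rfl

/-- This makes the switch reversible: the new graph and the four vertices determine the old one. -/
theorem switchEdges_switchEdges {G : SimpleGraph V} {u v x y : V} (huv : G.Adj u v)
    (hxy : G.Adj x y) (hux : ¬ G.Adj u x) (hvy : ¬ G.Adj v y) :
    (G.switchEdges u v x y).switchEdges u x v y = G := by
  ext a b
  rw [switchEdges_adj, switchEdges_adj]
  by_cases h1 : s(a, b) = s(u, v)
  · have : G.Adj a b := by rw [← mem_edgeSet, h1]; exact huv
    have := this.ne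
    tauto
  by_cases h2 : s(a, b) = s(x, y)
  · have : G.Adj a b := by rw [← mem_edgeSet, h2]; exact hxy
    have := this.ne
    tauto
  by_cases h3 : s(a, b) = s(u, x)
  · have : ¬ G.Adj a b := by rw [← mem_edgeSet, h3]; exact hux
    tauto
  by_cases h4 : s(a, b) = s(v, y)
  · have : ¬ G.Adj a b := by rw [← mem_edgeSet, h4]; exact hvy
    tauto
  tauto

theorem switchEdges_connected {G : SimpleGraph V} {S : Set V} {u v x y : V} (hu : u ∈ S) (hv : v ∈ S)
    (hx : x ∉ S) (hy : y ∉ S) (h1 : ((G.induce S).deleteEdges {s(⟨u, hu⟩, ⟨v, hv⟩)}).Connected)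
    (h2 : (G.induce Sᶜ).Connected) : (G.switchEdges u v x y).Connected := by
  set H := G.switchEdges u v x y with hH
  have hux : H.Adj x u := by
    rw [hH, switchEdges_adj]
    exact Or.inr ⟨by rintro rfl; exact hx hu, Or.inl Sym2.eq_swap⟩
  have hvy : H.Adj y v := by
    rw [hH, switchEdges_adj]
    exact Or.inr ⟨by rintro rfl; exact hy hv, Or.inr Sym2.eq_swap⟩
  have hin : ∀ w ∈ S, H.Reachable w u := by
    intro w hw
    let f : (G.induce S).deleteEdges {s(⟨u, hu⟩, ⟨v, hv⟩)} →g H :=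
      { toFun := Subtype.val
        map_rel' := by
          intro a b hab
          rw [deleteEdges_adj] at hab
          rw [hH, switchEdges_adj]
          refine Or.inl ⟨hab.1, fun h => hab.2 ?_, fun h => ?_⟩
          · rw [Set.mem_singleton_iff]
            rw [Sym2.eq_iff] at h ⊢
            simpa only [Subtype.ext_iff] using h
          · rw [Sym2.eq_iff] at h
            rcases h with ⟨h, -⟩ | ⟨h, -⟩
            · exact hx (h ▸ a.2)
            · exact hy (h ▸ a.2) }
    exact (h1.preconnected ⟨w, hw⟩ ⟨u, hu⟩).map f
  -- The edge `xy` may be a bridge of its side: a walk that would use it stops at `x` or `y`, each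
  -- joined to `S` by a new edge.
  have hout : ∀ p q : (Sᶜ : Set V), (G.induce Sᶜ).Walk p q → H.Reachable q.1 u →
      H.Reachable p.1 u := by
    intro p q W hp
    induction W with
    | nil => exact hp
    | @cons a b c hadj W ih =>
      have hb := ih hp
      by_cases hab : s(a.1, b.1) = s(x, y)
      · rw [Sym2.eq_iff] at hab
        rcases hab with ⟨h, -⟩ | ⟨h, -⟩
        · rw [h]; exact hux.reachable
        · rw [h]; exact hvy.reachable.trans (hin v hv)
      · refine (Adj.reachable ?_).trans hb
        rw [hH, switchEdges_adj]
        refine Or.inl ⟨hadj, fun h => ?_, hab⟩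
        rw [Sym2.eq_iff] at h
        rcases h with ⟨h, -⟩ | ⟨h, -⟩
        · exact a.2 (h ▸ hu)
        · exact a.2 (h ▸ hv)
  have hall : ∀ w, H.Reachable w u := by
    intro w
    by_cases hw : w ∈ S
    · exact hin w hw
    · obtain ⟨W⟩ := h2.preconnected ⟨w, hw⟩ ⟨x, hx⟩
      exact hout _ _ W hux.reachable
  exact (connected_iff _).2 ⟨fun a b => (hall a).trans (hall b).symm, ⟨u⟩⟩

/-- If all edges were bridges, the graph would be a tree, with fewer edges than vertices; degrees of
at least 2 force at least as many edges as vertices. -/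
theorem Connected.exists_adj_not_isBridge [Finite V] {G : SimpleGraph V} (hG : G.Connected) {D : ℕ}
    (hD : 2 ≤ D) (hreg : ∀ v, Nat.card (G.neighborSet v) = D) :
    ∃ u v, G.Adj u v ∧ (G.deleteEdges {s(u, v)}).Connected := by
  classical
  have := Fintype.ofFinite V
  by_contra! hcon
  have hac : G.IsAcyclic := by
    rw [isAcyclic_iff_forall_adj_isBridge]
    intro u v huv
    by_contra hb
    exact hcon u v huv (hG.connected_delete_edge_of_not_isBridge hb)
  have htree : G.IsTree := ⟨hG, hac⟩
  have h1 := htree.card_edgeFinset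
  have h2 := G.sum_degrees_eq_twice_card_edges
  have h3 : ∀ v, G.degree v = D := fun v => by
    rw [← hreg v, Nat.card_eq_fintype_card, card_neighborSet_eq_degree]
  simp only [h3, Finset.sum_const, Finset.card_univ, smul_eq_mul] at h2
  nlinarith

end SimpleGraph

/-! ### Gluing and switching of dart models. -/

namespace DartModel

variable {V X Y : Type*} {G : SimpleGraph V}

theorem card_neighborSet (M : DartModel G X) (v : V) :
    Nat.card (G.neighborSet v) = Nat.card {x // M.tail x = v} := by
  refine (Nat.card_congr (Equiv.ofBijective
    (fun x : {x // M.tail x = v} => (⟨M.tail (M.rev x.1), (M.adj_iff _ _).2 ⟨x.1, x.2, rfl⟩⟩ :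
      G.neighborSet v)) ⟨fun x y h => ?_, fun w => ?_⟩)).symm
  · exact Subtype.ext (M.ext_tail _ _ (x.2.trans y.2.symm) (congrArg Subtype.val h))
  · obtain ⟨x, hx, hx'⟩ := (M.adj_iff _ _).1 w.2
    exact ⟨⟨x, hx⟩, Subtype.ext hx'⟩

/-- The model of a graph made of models on the two sides of a partition into unions of
components. -/
def glue (S : Set V) (hS : ∀ a b, G.Adj a b → (a ∈ S ↔ b ∈ S)) (M : DartModel (G.induce S) X)
    (N : DartModel (G.induce Sᶜ) Y) : DartModel G (X ⊕ Y) where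
  rot := Equiv.sumCongr M.rot N.rot
  rev := Equiv.sumCongr M.rev N.rev
  tail := Sum.elim (fun x => (M.tail x).1) (fun y => (N.tail y).1)
  rev_rev := by rintro (x | x) <;> simp [M.rev_rev, N.rev_rev]
  tail_eq_iff := by
    have h1 : SameCycle.setoid M.rot ≤ Setoid.comap Sum.inl
        (SameCycle.setoid (Equiv.sumCongr M.rot N.rot)) := setoid_le_of_apply fun x =>
      sameCycle_apply_self (Equiv.sumCongr M.rot N.rot) (Sum.inl x)
    have h2 : SameCycle.setoid N.rot ≤ Setoid.comap Sum.inr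
        (SameCycle.setoid (Equiv.sumCongr M.rot N.rot)) := setoid_le_of_apply fun x =>
      sameCycle_apply_self (Equiv.sumCongr M.rot N.rot) (Sum.inr x)
    have h3 : SameCycle.setoid (Equiv.sumCongr M.rot N.rot) ≤ Setoid.ker
        (Sum.elim (fun x => (M.tail x).1) (fun y => (N.tail y).1)) := setoid_le_of_apply (by
      rintro (x | x)
      · exact congrArg Subtype.val (M.tail_rot x).symm
      · exact congrArg Subtype.val (N.tail_rot x).symm)
    intro x y
    refine ⟨fun h => ?_, fun h => h3 h⟩
    rcases x with x | x <;> rcases y with y | y <;> simp only [Sum.elim_inl, Sum.elim_inr] at h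
    · exact h1 ((M.tail_eq_iff x y).1 (Subtype.ext h))
    · exact absurd (h ▸ (M.tail x).2) (N.tail y).2
    · exact absurd (h ▸ (M.tail y).2) (N.tail x).2
    · exact h2 ((N.tail_eq_iff x y).1 (Subtype.ext h))
  tail_surjective v := by
    by_cases hv : v ∈ S
    · obtain ⟨x, hx⟩ := M.tail_surjective ⟨v, hv⟩
      exact ⟨Sum.inl x, congrArg Subtype.val hx⟩
    · obtain ⟨x, hx⟩ := N.tail_surjective ⟨v, hv⟩
      exact ⟨Sum.inr x, congrArg Subtype.val hx⟩
  adj_iff a b := by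
    constructor
    · intro hab
      by_cases ha : a ∈ S
      · obtain ⟨x, hx, hx'⟩ := (M.adj_iff ⟨a, ha⟩ ⟨b, (hS a b hab).1 ha⟩).1 hab
        exact ⟨Sum.inl x, congrArg Subtype.val hx, congrArg Subtype.val hx'⟩
      · obtain ⟨x, hx, hx'⟩ := (N.adj_iff ⟨a, ha⟩ ⟨b, (not_congr (hS a b hab)).1 ha⟩).1 hab
        exact ⟨Sum.inr x, congrArg Subtype.val hx, congrArg Subtype.val hx'⟩
    · rintro ⟨x | x, rfl, rfl⟩
      · exact M.adj_tail x
      · exact N.adj_tail x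
  ext_tail := by
    rintro (x | x) (y | y) h h' <;> simp only [Sum.elim_inl, Sum.elim_inr] at h
    · exact congrArg Sum.inl (M.ext_tail x y (Subtype.ext h) (Subtype.ext h'))
    · exact absurd (h ▸ (M.tail x).2) (N.tail y).2
    · exact absurd (h ▸ (M.tail y).2) (N.tail x).2
    · exact congrArg Sum.inr (N.ext_tail x y (Subtype.ext h) (Subtype.ext h'))

theorem le_numFaces_glue [Finite X] [Finite Y] (S : Set V)
    (hS : ∀ a b, G.Adj a b → (a ∈ S ↔ b ∈ S)) (M : DartModel (G.induce S) X)
    (N : DartModel (G.induce Sᶜ) Y) :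
    M.numFaces + N.numFaces ≤ (glue S hS M N).numFaces := by
  rw [numFaces, numFaces, numFaces, numCycles, numCycles, ← Nat.card_sum]
  refine card_le_numCycles _ (Sum.map (Quotient.mk _) (Quotient.mk _))
    (Quotient.mk_surjective.sumMap Quotient.mk_surjective) ?_
  rintro (x | x)
  · exact congrArg Sum.inl (Quotient.sound (sameCycle_apply_self _ x).symm)
  · exact congrArg Sum.inr (Quotient.sound (sameCycle_apply_self _ x).symm)

/-- The new reversal pairs `d` with `e` and `rev d` with `rev e`. Writing it as `rev` times two
transpositions shows that the face permutation also changes by two transpositions, so at most two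
faces are lost. -/
theorem switch_apply [DecidableEq X] (M : DartModel G X) {d e : X} (h1 : e ≠ d) (h2 : e ≠ M.rev d)
    (z : X) : (M.rev * Equiv.swap d (M.rev e) * Equiv.swap e (M.rev d)) z =
      if z = d then e else if z = e then d else if z = M.rev d then M.rev e else
        if z = M.rev e then M.rev d else M.rev z := by
  have h3 := M.rev_ne d
  have h4 := M.rev_ne e
  have h5 : M.rev e ≠ d := fun h => h2 (by rw [← h, M.rev_rev])
  have h6 : M.rev e ≠ M.rev d := fun h => h1 (M.rev.injective h)
  simp only [mul_apply]
  split_ifs with ha hb hc hd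
  · subst ha
    rw [Equiv.swap_apply_of_ne_of_ne h1.symm h3.symm, Equiv.swap_apply_left, M.rev_rev]
  · subst hb
    rw [Equiv.swap_apply_left, Equiv.swap_apply_of_ne_of_ne h3 h6.symm, M.rev_rev]
  · subst hc
    rw [Equiv.swap_apply_right, Equiv.swap_apply_of_ne_of_ne h1 h4.symm]
  · subst hd
    rw [Equiv.swap_apply_of_ne_of_ne h4 h6, Equiv.swap_apply_right]
  · rw [Equiv.swap_apply_of_ne_of_ne hb hc, Equiv.swap_apply_of_ne_of_ne ha hd]

theorem tail_rev_mem_iff (M : DartModel G X) {S : Set V}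
    (hS : ∀ a b, G.Adj a b → (a ∈ S ↔ b ∈ S)) (x : X) : M.tail (M.rev x) ∈ S ↔ M.tail x ∈ S :=
  (hS _ _ (M.adj_tail x)).symm

/-- The model after a switch of two edges in different components. -/
def switch [DecidableEq X] (M : DartModel G X) (S : Set V)
    (hS : ∀ a b, G.Adj a b → (a ∈ S ↔ b ∈ S)) (d e : X) (hd : M.tail d ∈ S) (he : M.tail e ∉ S) :
    DartModel (G.switchEdges (M.tail d) (M.tail (M.rev d)) (M.tail e) (M.tail (M.rev e))) X :=
  have h1 : e ≠ d := by rintro rfl; exact he hd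
  have h2 : e ≠ M.rev d := by rintro rfl; exact he ((M.tail_rev_mem_iff hS d).2 hd)
  have h3 : M.rev e ≠ d := fun h => h2 (by rw [← h, M.rev_rev])
  have h4 : M.rev e ≠ M.rev d := fun h => h1 (M.rev.injective h)
  have hd' : M.tail (M.rev d) ∈ S := (M.tail_rev_mem_iff hS d).2 hd
  have he' : M.tail (M.rev e) ∉ S := fun h => he ((M.tail_rev_mem_iff hS e).1 h)
  have hdd : M.tail d ≠ M.tail (M.rev d) := (M.adj_tail d).ne
  have hee : M.tail e ≠ M.tail (M.rev e) := (M.adj_tail e).ne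
  have hrd := M.rev_ne d
  have hre := M.rev_ne e
  { rot := M.rot
    rev := M.rev * Equiv.swap d (M.rev e) * Equiv.swap e (M.rev d)
    tail := M.tail
    rev_rev := by
      intro z
      have hz := M.rev_rev z
      have hd2 := M.rev_rev d
      have he2 := M.rev_rev e
      simp only [M.switch_apply h1 h2]
      grind
    tail_eq_iff := M.tail_eq_iff
    tail_surjective := M.tail_surjective
    adj_iff := fun a b => by
      simp only [M.switch_apply h1 h2, SimpleGraph.switchEdges_adj]
      constructor
      · rintro (⟨hab, hne, hne'⟩ | ⟨hab, h | h⟩)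
        · obtain ⟨z, rfl, rfl⟩ := (M.adj_iff a b).1 hab
          refine ⟨z, rfl, ?_⟩
          rw [if_neg, if_neg, if_neg, if_neg]
          · rintro rfl; rw [M.rev_rev] at hne'; exact hne' Sym2.eq_swap
          · rintro rfl; rw [M.rev_rev] at hne; exact hne Sym2.eq_swap
          · rintro rfl; exact hne' rfl
          · rintro rfl; exact hne rfl
        · rcases Sym2.eq_iff.1 h with ⟨rfl, rfl⟩ | ⟨rfl, rfl⟩
          · exact ⟨d, rfl, by rw [if_pos rfl]⟩
          · exact ⟨e, rfl, by rw [if_neg h1, if_pos rfl]⟩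
        · rcases Sym2.eq_iff.1 h with ⟨rfl, rfl⟩ | ⟨rfl, rfl⟩
          · exact ⟨M.rev d, rfl, by rw [if_neg hrd, if_neg h2.symm, if_pos rfl]⟩
          · exact ⟨M.rev e, rfl, by rw [if_neg h3, if_neg hre, if_neg h4, if_pos rfl]⟩
      · rintro ⟨z, rfl, rfl⟩
        split_ifs with ha hb hc hd0
        · subst ha; exact Or.inr ⟨fun h => he (h ▸ hd), Or.inl rfl⟩
        · subst hb; exact Or.inr ⟨fun h => he (h ▸ hd), Or.inl Sym2.eq_swap⟩
        · subst hc; exact Or.inr ⟨fun h => he' (h ▸ hd'), Or.inr rfl⟩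
        · subst hd0; exact Or.inr ⟨fun h => he' (h ▸ hd'), Or.inr Sym2.eq_swap⟩
        · refine Or.inl ⟨M.adj_tail z, fun h => ?_, fun h => ?_⟩
          · rcases Sym2.eq_iff.1 h with ⟨h, h'⟩ | ⟨h, h'⟩
            · exact ha (M.ext_tail _ _ h h')
            · exact hc (M.ext_tail _ _ h (by rw [h', M.rev_rev]))
          · rcases Sym2.eq_iff.1 h with ⟨h, h'⟩ | ⟨h, h'⟩
            · exact hb (M.ext_tail _ _ h h')
            · exact hd0 (M.ext_tail _ _ h (by rw [h', M.rev_rev]))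
    ext_tail := fun z w => by
      have hz := M.tail_rev_mem_iff hS z
      have hw := M.tail_rev_mem_iff hS w
      have hzw := M.ext_tail z w
      simp only [M.switch_apply h1 h2]
      grind }

theorem switch_numFaces [DecidableEq X] [Finite X] (M : DartModel G X) (S : Set V)
    (hS : ∀ a b, G.Adj a b → (a ∈ S ↔ b ∈ S)) (d e : X) (hd : M.tail d ∈ S) (he : M.tail e ∉ S) :
    M.numFaces ≤ (M.switch S hS d e hd he).numFaces + 2 := by
  have h1 := numCycles_le_mul_swap (M.rot * M.rev) d (M.rev e)
  have h2 := numCycles_le_mul_swap (M.rot * M.rev * Equiv.swap d (M.rev e)) e (M.rev d)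
  have h3 : (M.switch S hS d e hd he).numFaces =
      numCycles (M.rot * M.rev * Equiv.swap d (M.rev e) * Equiv.swap e (M.rev d)) := by
    simp only [mul_assoc]; rfl
  rw [h3, numFaces]
  omega

end DartModel

/-! ### Regular planar graphs and their joining by a switch. -/

/-- A planar graph with all degrees equal to `D`. -/
def IsRegularPlanar {V : Type} (D : ℕ) (G : SimpleGraph V) : Prop :=
  (∃ (X : Type) (_ : Finite X) (M : DartModel G X), M.Spherical) ∧
    ∀ v, Nat.card (G.neighborSet v) = D

theorem IsRegularPlanar.iso {V W : Type} {D : ℕ} {G : SimpleGraph V} {H : SimpleGraph W}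
    (hG : IsRegularPlanar D G) (e : G ≃g H) : IsRegularPlanar D H := by
  obtain ⟨⟨X, hX, M, hM⟩, hdeg⟩ := hG
  refine ⟨⟨X, hX, M.mapIso e, M.mapIso_spherical e hM⟩, fun w => ?_⟩
  rw [← hdeg (e.symm w)]
  exact Nat.card_congr (e.symm.mapNeighborSet w)

theorem IsRegularPlanar.induce {V : Type} [Finite V] {D : ℕ} {G : SimpleGraph V}
    (hG : IsRegularPlanar D G) {S : Set V} (hS : ∀ a b, G.Adj a b → (a ∈ S ↔ b ∈ S)) :
    IsRegularPlanar D (G.induce S) := by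
  obtain ⟨⟨X, hX, M, hM⟩, hdeg⟩ := hG
  refine ⟨⟨_, inferInstance, M.restrict S hS, M.restrict_spherical hM S hS⟩, fun v => ?_⟩
  rw [← hdeg v.1]
  exact Nat.card_congr
    { toFun := fun w => ⟨w.1.1, w.2⟩
      invFun := fun w => ⟨⟨w.1, (hS _ _ w.2).1 v.2⟩, w.2⟩
      left_inv := fun _ => rfl
      right_inv := fun _ => rfl }

/-- Two connected regular planar graphs can be joined by switching an edge of one with an edge of
the other. -/
theorem exists_switch_regularPlanar {V : Type} [Finite V] {D : ℕ} (hD : 2 ≤ D)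
    {G : SimpleGraph V} {S : Set V} (hS : ∀ a b, G.Adj a b → (a ∈ S ↔ b ∈ S))
    (h1 : IsRegularPlanar D (G.induce S)) (h2 : IsRegularPlanar D (G.induce Sᶜ))
    (hc1 : (G.induce S).Connected) (hc2 : (G.induce Sᶜ).Connected) :
    ∃ u v x y, u ∈ S ∧ x ∉ S ∧ G.Adj u v ∧ G.Adj x y ∧
      IsRegularPlanar D (G.switchEdges u v x y) ∧ (G.switchEdges u v x y).Connected := by
  classical
  obtain ⟨u, v, huv, hcon⟩ := hc1.exists_adj_not_isBridge hD h1.2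
  obtain ⟨⟨X, hX, M, hM⟩, hdeg1⟩ := h1
  obtain ⟨⟨Y, hY, N, hN⟩, hdeg2⟩ := h2
  obtain ⟨x⟩ := hc2.nonempty
  obtain ⟨y, hxy⟩ := N.exists_adj x
  obtain ⟨d, hd, hd'⟩ := (M.adj_iff u v).1 huv
  obtain ⟨e, he, he'⟩ := (N.adj_iff x y).1 hxy
  have hH : (G.switchEdges u.1 v.1 x.1 y.1).Connected :=
    SimpleGraph.switchEdges_connected u.2 v.2 x.2 y.2 hcon hc2
  let Q := DartModel.glue S hS M N
  have hdQ : Q.tail (Sum.inl d) = u.1 := congrArg Subtype.val hd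
  have hdQ' : Q.tail (Q.rev (Sum.inl d)) = v.1 := congrArg Subtype.val hd'
  have heQ : Q.tail (Sum.inr e) = x.1 := congrArg Subtype.val he
  have heQ' : Q.tail (Q.rev (Sum.inr e)) = y.1 := congrArg Subtype.val he'
  have hR := Q.switch_numFaces S hS (Sum.inl d) (Sum.inr e) (hdQ ▸ u.2) (heQ ▸ x.2)
  have htail : (Q.switch S hS (Sum.inl d) (Sum.inr e) (hdQ ▸ u.2) (heQ ▸ x.2)).tail = Q.tail := rfl
  -- The type of the switched model mentions tails of darts. Once the model is a variable, these can
  -- be rewritten to the four vertices.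
  generalize Q.switch S hS (Sum.inl d) (Sum.inr e) (hdQ ▸ u.2) (heQ ▸ x.2) = R at hR htail
  revert R
  rw [hdQ, hdQ', heQ, heQ']
  intro R hR htail
  refine ⟨u, v, x, y, u.2, x.2, huv, hxy, ⟨⟨X ⊕ Y, inferInstance, R, R.spherical_of_le ?_⟩, ?_⟩, hH⟩
  -- The doubled Euler relations of two spheres sum to a constant 8. Losing at most two faces leaves
  -- at least 4, which is what one connected sphere needs.
  · have hF := DartModel.le_numFaces_glue S hS M N
    change _ ≤ Q.numFaces at hF
    have hV : Nat.card V = Nat.card S + Nat.card (Sᶜ : Set V) := by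
      rw [← Nat.card_sum]
      exact Nat.card_congr (Equiv.sumCompl fun x => x ∈ S).symm
    have hone : ∀ {W : Type} {K : SimpleGraph W}, K.Connected →
        Nat.card K.ConnectedComponent = 1 := by
      intro W K hK
      have := hK.nonempty
      have := hK.preconnected.subsingleton_connectedComponent
      exact Nat.card_eq_one_iff_unique.2
        ⟨this, ⟨K.connectedComponentMk (Classical.arbitrary W)⟩⟩
    rw [DartModel.Spherical, hone hc1] at hM
    rw [DartModel.Spherical, hone hc2] at hN
    rw [hone hH, Nat.card_sum]
    omega
  · intro w
    rw [R.card_neighborSet, htail, ← Q.card_neighborSet]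
    by_cases hw : w ∈ S
    · rw [← hdeg1 ⟨w, hw⟩]
      exact Nat.card_congr
        { toFun := fun z => ⟨⟨z.1, (hS _ _ z.2).1 hw⟩, z.2⟩
          invFun := fun z => ⟨z.1.1, z.2⟩
          left_inv := fun _ => rfl
          right_inv := fun _ => rfl }
    · rw [← hdeg2 ⟨w, hw⟩]
      exact Nat.card_congr
        { toFun := fun z => ⟨⟨z.1, (not_congr (hS _ _ z.2)).1 hw⟩, z.2⟩
          invFun := fun z => ⟨z.1.1, z.2⟩
          left_inv := fun _ => rfl
          right_inv := fun _ => rfl }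

/-! ### Disjoint unions and the two counting inequalities. -/

/-- The graph with given parts on a set of vertices and on its complement. -/
def SimpleGraph.disjointJoin {V : Type*} (S : Set V) (A : SimpleGraph S)
    (B : SimpleGraph (Sᶜ : Set V)) : SimpleGraph V where
  Adj a b := (∃ (ha : a ∈ S) (hb : b ∈ S), A.Adj ⟨a, ha⟩ ⟨b, hb⟩) ∨
    ∃ (ha : a ∈ Sᶜ) (hb : b ∈ Sᶜ), B.Adj ⟨a, ha⟩ ⟨b, hb⟩
  symm := ⟨by
    rintro a b (⟨ha, hb, h⟩ | ⟨ha, hb, h⟩)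
    · exact Or.inl ⟨hb, ha, h.symm⟩
    · exact Or.inr ⟨hb, ha, h.symm⟩⟩
  loopless := ⟨by
    rintro a (⟨ha, hb, h⟩ | ⟨ha, hb, h⟩)
    · exact h.ne rfl
    · exact h.ne rfl⟩

namespace SimpleGraph

variable {V : Type*} (S : Set V)

theorem disjointJoin_closed (A : SimpleGraph S) (B : SimpleGraph (Sᶜ : Set V)) (a b : V)
    (h : (disjointJoin S A B).Adj a b) : a ∈ S ↔ b ∈ S := by
  rcases h with ⟨ha, hb, -⟩ | ⟨ha, hb, -⟩
  · exact iff_of_true ha hb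
  · exact iff_of_false ha hb

theorem induce_disjointJoin (A : SimpleGraph S) (B : SimpleGraph (Sᶜ : Set V)) :
    (disjointJoin S A B).induce S = A := by
  ext a b
  constructor
  · rintro (⟨ha, hb, h⟩ | ⟨ha, hb, h⟩)
    · exact h
    · exact absurd a.2 ha
  · exact fun h => Or.inl ⟨a.2, b.2, h⟩

theorem induce_compl_disjointJoin (A : SimpleGraph S) (B : SimpleGraph (Sᶜ : Set V)) :
    (disjointJoin S A B).induce Sᶜ = B := by
  ext a b
  constructor
  · rintro (⟨ha, hb, h⟩ | ⟨ha, hb, h⟩)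
    · exact absurd ha a.2
    · exact h
  · exact fun h => Or.inr ⟨a.2, b.2, h⟩

theorem disjointJoin_induce {G : SimpleGraph V} (hS : ∀ a b, G.Adj a b → (a ∈ S ↔ b ∈ S)) :
    disjointJoin S (G.induce S) (G.induce Sᶜ) = G := by
  ext a b
  constructor
  · rintro (⟨ha, hb, h⟩ | ⟨ha, hb, h⟩) <;> exact h
  · intro h
    by_cases ha : a ∈ S
    · exact Or.inl ⟨ha, (hS a b h).1 ha, h⟩
    · exact Or.inr ⟨ha, (not_congr (hS a b h)).1 ha, h⟩

end SimpleGraph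

open SimpleGraph

/-- The number of `D`-regular planar graphs on `V`. -/
noncomputable def numRegular (D : ℕ) (V : Type) : ℕ :=
  Nat.card {G : SimpleGraph V // IsRegularPlanar D G}

/-- The number of connected `D`-regular planar graphs on `V`. -/
noncomputable def numConnected (D : ℕ) (V : Type) : ℕ :=
  Nat.card {G : SimpleGraph V // IsRegularPlanar D G ∧ G.Connected}

theorem numRegular_congr (D : ℕ) {V W : Type} (e : V ≃ W) : numRegular D V = numRegular D W :=
  Nat.card_congr (e.simpleGraph.subtypeEquiv fun G =>
    ⟨fun h => h.iso (Iso.comap e.symm G).symm, fun h => h.iso (Iso.comap e.symm G)⟩)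

theorem numConnected_congr (D : ℕ) {V W : Type} (e : V ≃ W) :
    numConnected D V = numConnected D W :=
  Nat.card_congr (e.simpleGraph.subtypeEquiv fun G =>
    ⟨fun h => ⟨h.1.iso (Iso.comap e.symm G).symm, (Iso.comap e.symm G).connected_iff.2 h.2⟩,
     fun h => ⟨h.1.iso (Iso.comap e.symm G), (Iso.comap e.symm G).connected_iff.1 h.2⟩⟩)

section PartCounts

variable {N : ℕ} (S : Finset (Fin N))

theorem numRegular_coe_compl (D : ℕ) :
    numRegular D ((S : Set (Fin N))ᶜ : Set (Fin N)) = numRegular D (Fin (N - S.card)) := by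
  refine numRegular_congr D (Finite.equivFinOfCardEq ?_)
  rw [← Finset.coe_compl, Nat.card_coe_set_eq, Set.ncard_coe_finset, Finset.card_compl,
    Fintype.card_fin]

theorem numConnected_coe_compl (D : ℕ) :
    numConnected D ((S : Set (Fin N))ᶜ : Set (Fin N)) = numConnected D (Fin (N - S.card)) := by
  refine numConnected_congr D (Finite.equivFinOfCardEq ?_)
  rw [← Finset.coe_compl, Nat.card_coe_set_eq, Set.ncard_coe_finset, Finset.card_compl,
    Fintype.card_fin]

theorem numConnected_coe (D : ℕ) :
    numConnected D (S : Set (Fin N)) = numConnected D (Fin S.card) := by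
  refine numConnected_congr D (Finite.equivFinOfCardEq ?_)
  rw [Nat.card_coe_set_eq, Set.ncard_coe_finset]

end PartCounts

/-- A label set of size `n` with connected graphs on it and on its complement is mapped to the
switched graph together with the quadruple `(u, v, x, y)`. Injectivity: the quadruple undoes the
switch, and the label set is then the component of `u`. -/
theorem choose_mul_numConnected_le {D : ℕ} (hD : 2 ≤ D) (n m : ℕ) :
    (n + m).choose n * (numConnected D (Fin n) * numConnected D (Fin m)) ≤
      (n + m) ^ 4 * numConnected D (Fin (n + m)) := by
  classical
  let V := Fin (n + m)
  let T := Σ S : {S : Finset V // S.card = n},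
    {A : SimpleGraph (S.1 : Set V) // IsRegularPlanar D A ∧ A.Connected} ×
    {B : SimpleGraph ((S.1 : Set V)ᶜ : Set V) // IsRegularPlanar D B ∧ B.Connected}
  have hT : Nat.card T =
      (n + m).choose n * (numConnected D (Fin n) * numConnected D (Fin m)) := by
    rw [Nat.card_sigma]
    have : ∀ S : {S : Finset V // S.card = n},
        Nat.card ({A : SimpleGraph (S.1 : Set V) // IsRegularPlanar D A ∧ A.Connected} ×
          {B : SimpleGraph ((S.1 : Set V)ᶜ : Set V) // IsRegularPlanar D B ∧ B.Connected}) =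
        numConnected D (Fin n) * numConnected D (Fin m) := by
      rintro ⟨S, hS⟩
      rw [Nat.card_prod]
      have h1 := numConnected_coe S D
      have h2 := numConnected_coe_compl S D
      rw [hS] at h1 h2
      rw [Nat.add_sub_cancel_left] at h2
      rw [← h1, ← h2]
      rfl
    simp only [this, Finset.sum_const, smul_eq_mul, Finset.card_univ]
    rw [Fintype.card_finset_len, Fintype.card_fin]
  rw [← hT]
  have hcard : Nat.card ((V × V × V × V) × {H : SimpleGraph V // IsRegularPlanar D H ∧ H.Connected})
      = (n + m) ^ 4 * numConnected D (Fin (n + m)) := by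
    simp only [Nat.card_prod, V, Nat.card_fin, numConnected]
    ring
  rw [← hcard]
  have hswitch : ∀ t : T, ∃ q : (V × V × V × V) ×
      {H : SimpleGraph V // IsRegularPlanar D H ∧ H.Connected},
      q.1.1 ∈ t.1.1 ∧ q.2.1.switchEdges q.1.1 q.1.2.2.1 q.1.2.1 q.1.2.2.2 =
        disjointJoin (t.1.1 : Set V) t.2.1.1 t.2.2.1 := by
    rintro ⟨⟨S, hS⟩, ⟨A, hA⟩, ⟨B, hB⟩⟩
    have hcl := disjointJoin_closed (S : Set V) A B
    obtain ⟨u, v, x, y, hu, hx, huv, hxy, hreg, hcon⟩ :=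
      exists_switch_regularPlanar hD hcl
        (by rw [induce_disjointJoin]; exact hA.1) (by rw [induce_compl_disjointJoin]; exact hB.1)
        (by rw [induce_disjointJoin]; exact hA.2) (by rw [induce_compl_disjointJoin]; exact hB.2)
    refine ⟨⟨(u, v, x, y), ⟨_, hreg, hcon⟩⟩, hu, switchEdges_switchEdges huv hxy ?_ ?_⟩
    · exact fun h => hx ((hcl _ _ h).1 hu)
    · exact fun h => hx ((hcl _ _ hxy).2 ((hcl _ _ h).1 ((hcl _ _ huv).1 hu)))
  choose f hf1 hf2 using hswitch
  refine Nat.card_le_card_of_injective f fun t t' htt => ?_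
  have hjoin : disjointJoin (t.1.1 : Set V) t.2.1.1 t.2.2.1 =
      disjointJoin (t'.1.1 : Set V) t'.2.1.1 t'.2.2.1 := by rw [← hf2, ← hf2, htt]
  have hcomp : ∀ t : T, (t.1.1 : Set V) =
      {w | (disjointJoin (t.1.1 : Set V) t.2.1.1 t.2.2.1).Reachable (f t).1.1 w} := by
    intro t
    have hcl := disjointJoin_closed (t.1.1 : Set V) t.2.1.1 t.2.2.1
    ext w
    constructor
    · intro hw
      have hc : ((disjointJoin (t.1.1 : Set V) t.2.1.1 t.2.2.1).induce
          (t.1.1 : Set V)).Connected := by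
        rw [induce_disjointJoin]; exact t.2.1.2.2
      exact (hc.preconnected ⟨_, hf1 t⟩ ⟨w, hw⟩).map (Embedding.induce _).toHom
    · intro hw
      exact (hw.induce_of_closed hcl (hf1 t)).1
  have hS : t.1 = t'.1 := by
    apply Subtype.ext
    rw [← Finset.coe_inj, hcomp t, hcomp t', hjoin, htt]
  obtain ⟨S, ⟨A, hA⟩, ⟨B, hB⟩⟩ := t
  obtain ⟨S', ⟨A', hA'⟩, ⟨B', hB'⟩⟩ := t'
  obtain rfl : S = S' := hS
  have h1 : A = A' := by
    rw [← induce_disjointJoin _ A B, ← induce_disjointJoin _ A' B']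
    exact congrArg _ hjoin
  have h2 : B = B' := by
    rw [← induce_compl_disjointJoin _ A B, ← induce_compl_disjointJoin _ A' B']
    exact congrArg _ hjoin
  subst h1 h2
  rfl

/-- A graph with a marked vertex is determined by the component of that vertex, with the mark in it,
and the rest. This is the inequality form of the exponential formula. -/
theorem mul_numRegular_le (D n : ℕ) :
    n * numRegular D (Fin n) ≤ ∑ k ∈ Finset.range (n + 1),
      n.choose k * (k * numConnected D (Fin k) * numRegular D (Fin (n - k))) := by
  classical
  let V := Fin n
  let T := Σ S : Finset V, ↥(S : Set V) ×
    {A : SimpleGraph (S : Set V) // IsRegularPlanar D A ∧ A.Connected} ×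
    {B : SimpleGraph ((S : Set V)ᶜ : Set V) // IsRegularPlanar D B}
  have hT : Nat.card T = ∑ k ∈ Finset.range (n + 1),
      n.choose k * (k * numConnected D (Fin k) * numRegular D (Fin (n - k))) := by
    have hsum := Finset.sum_powerset_apply_card (fun k => k * numConnected D (Fin k) *
      numRegular D (Fin (n - k))) (x := (Finset.univ : Finset V))
    simp only [smul_eq_mul, Finset.card_univ, V, Fintype.card_fin, Finset.powerset_univ] at hsum
    rw [← hsum, Nat.card_sigma]
    refine Finset.sum_congr rfl fun S _ => ?_
    rw [Nat.card_prod, Nat.card_prod, Nat.card_coe_set_eq, Set.ncard_coe_finset,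
      ← numConnected_coe S D, ← numRegular_coe_compl S D, mul_assoc]
    rfl
  have hL : Nat.card (V × {G : SimpleGraph V // IsRegularPlanar D G}) =
      n * numRegular D (Fin n) := by
    rw [Nat.card_prod, Nat.card_fin, numRegular]
  rw [← hT, ← hL]
  have hexists : ∀ q : V × {G : SimpleGraph V // IsRegularPlanar D G}, ∃ t : T,
      t.2.1.1 = q.1 ∧ disjointJoin (t.1 : Set V) t.2.2.1.1 t.2.2.2.1 = q.2.1 := by
    rintro ⟨v, G, hG⟩
    let S : Finset V := Finset.univ.filter fun w => G.Reachable v w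
    have hmem : ∀ w, w ∈ (S : Set V) ↔ G.Reachable v w := fun w => by simp [S]
    have hcl : ∀ a b, G.Adj a b → (a ∈ (S : Set V) ↔ b ∈ (S : Set V)) := by
      intro a b hab
      rw [hmem, hmem]
      exact ⟨fun h => h.trans hab.reachable, fun h => h.trans hab.symm.reachable⟩
    have hv : v ∈ (S : Set V) := (hmem v).2 (Reachable.refl v)
    have hcl' : ∀ a b, G.Adj a b → (a ∈ (S : Set V)ᶜ ↔ b ∈ (S : Set V)ᶜ) :=
      fun a b h => not_congr (hcl a b h)
    have hr : ∀ w : (S : Set V), (G.induce (S : Set V)).Reachable ⟨v, hv⟩ w := fun w =>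
      (((hmem w.1).1 w.2).induce_of_closed hcl hv).2
    have hcon : (G.induce (S : Set V)).Connected :=
      (connected_iff _).2 ⟨fun a b => (hr a).symm.trans (hr b), ⟨⟨v, hv⟩⟩⟩
    exact ⟨⟨S, ⟨v, hv⟩, ⟨_, hG.induce hcl, hcon⟩, ⟨_, hG.induce hcl'⟩⟩, rfl,
      disjointJoin_induce _ hcl⟩
  choose f hf1 hf2 using hexists
  refine Nat.card_le_card_of_injective f fun q q' hqq => ?_
  refine Prod.ext ?_ (Subtype.ext ?_)
  · rw [← hf1 q, ← hf1 q', hqq]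
  · rw [← hf2 q, ← hf2 q', hqq]

/-! ### Noncrossing involutions of a polygon. -/

namespace NoncrossingInvolution

theorem sameCycle_finRotate (k : ℕ) (i : Fin (k + 1)) : (finRotate (k + 1)).SameCycle 0 i := by
  induction i using Fin.induction with
  | zero => exact SameCycle.refl _ _
  | succ i ih =>
    refine ih.trans ?_
    have := sameCycle_apply_self (finRotate (k + 1)) i.castSucc
    rwa [finRotate_apply, Fin.coeSucc_eq_succ] at this

theorem numCycles_finRotate (k : ℕ) : numCycles (finRotate (k + 1)) = 1 := by
  rw [numCycles, Nat.card_eq_one_iff_unique]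
  refine ⟨⟨fun p q => Quotient.inductionOn₂ p q fun x y => Quotient.sound ?_⟩,
    ⟨Quotient.mk _ 0⟩⟩
  exact (sameCycle_finRotate k x).symm.trans (sameCycle_finRotate k y)

theorem val_finRotate_of_lt {N : ℕ} {m k : Fin N} (h : m < k) : (finRotate N m : ℕ) = m + 1 := by
  obtain _ | n := N
  · exact m.elim0
  · rw [coe_finRotate_of_ne_last]
    exact (h.trans_le (Fin.le_last k)).ne

end NoncrossingInvolution

open NoncrossingInvolution

/-- An involution that, read as a set of chords of a regular polygon, is planar. -/
structure IsPlanarInvolution {N : ℕ} (f : Equiv.Perm (Fin N)) : Prop where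
  involutive : ∀ i, f (f i) = i
  numCycles_eq : 2 * numCycles (finRotate N * f) = numMoved f + 2

namespace IsPlanarInvolution

variable {N : ℕ} {f g : Equiv.Perm (Fin N)}

/-- The chord from `i` cuts off the arc from `i + 1` to `f i`, which contains `j` but not `f j`. A
second chord from `j` to `f j` rejoins the pieces, so these two chords leave one cycle. The other
chords add at most one cycle each, too few for planarity. -/
theorem not_crossing (hf : IsPlanarInvolution f) {i j : Fin N} (hij : i < j) (hji : j < f i)
    (hij' : f i < f j) : False := by
  obtain ⟨n, rfl⟩ : ∃ n, N = n + 1 := ⟨N - 1, by have := i.2; omega⟩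
  set z := finRotate (n + 1) with hz
  have h1 := hf.involutive
  set f1 := Equiv.swap i (f i) * f with hf1
  have h2 : ∀ x, f1 (f1 x) = x := swap_mul_involutive h1 i
  have h3 : f1 j = f j := by
    rw [hf1, swap_mul_apply_of_involutive h1, if_neg]
    rintro (h | h)
    · exact hij.ne h.symm
    · exact hji.ne h
  set f2 := Equiv.swap j (f1 j) * f1 with hf2
  have h4 : ∀ x, f2 (f2 x) = x := swap_mul_involutive h2 j
  have h5 : numMoved f = numMoved f1 + 2 := numMoved_swap_mul h1 (hij.trans hji).ne'
  have h6 : numMoved f1 = numMoved f2 + 2 :=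
    numMoved_swap_mul h2 (by rw [h3]; exact (hji.trans hij').ne')
  have h7 : z * f = z * Equiv.swap i (f i) * Equiv.swap j (f j) * f2 := by
    rw [hf2, hf1, h3]
    simp [mul_assoc]
  have h8 := numCycles_mul_involution_le (z * Equiv.swap i (f i) * Equiv.swap j (f j)) f2 h4
  have h9 := numCycles_mul_swap_le z i (f i)
  have h10 : ¬ (z * Equiv.swap i (f i)).SameCycle j (f j) := by
    intro h
    have := h.of_apply_mem (s := {m | i < m ∧ m ≤ f i}) ?_ ⟨hij, hji.le⟩
    · exact absurd this.2 (not_le.2 hij')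
    rintro m ⟨hm, hm'⟩
    change i < z (Equiv.swap i (f i) m) ∧ z (Equiv.swap i (f i) m) ≤ f i
    rcases hm'.eq_or_lt with rfl | hlt
    · rw [Equiv.swap_apply_right]
      have := val_finRotate_of_lt hm
      rw [← hz] at this
      rw [Fin.lt_def, Fin.le_def, this]
      rw [Fin.lt_def] at hm
      omega
    · rw [Equiv.swap_apply_of_ne_of_ne hm.ne' hlt.ne]
      have := val_finRotate_of_lt hlt
      rw [← hz] at this
      rw [Fin.lt_def, Fin.le_def, this]
      rw [Fin.lt_def] at hm hlt
      omega
  have h11 := numCycles_mul_swap_of_not_sameCycle h10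
  have h12 := hf.numCycles_eq
  have h13 : numCycles z = 1 := numCycles_finRotate n
  rw [← h7] at h8
  rw [← hz] at h12
  omega

/-- As with balanced brackets, the sets of opening and closing points determine the matching. By
induction on a closing point `c`: if `f c < g c`, then the `f`-partner of the opening point `g c` is
neither before `c`, by induction, nor `c` itself, and if it is after `c` two chords cross. -/
theorem eq_of_lt_iff (hf : IsPlanarInvolution f) (hg : IsPlanarInvolution g)
    (h1 : ∀ i, f i < i ↔ g i < i) (h2 : ∀ i, i < f i ↔ i < g i) : f = g := by
  have key : ∀ {f g : Equiv.Perm (Fin N)}, IsPlanarInvolution f → IsPlanarInvolution g →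
      (∀ i, i < f i ↔ i < g i) → ∀ c, f c < c → g c < c →
      (∀ e < c, f e < e → g e = f e) → ¬ f c < g c := by
    intro f g hf hg h2 c hfc hgc ih hlt
    have hb : g c < f (g c) := (h2 _).2 (by rw [hg.involutive]; exact hgc)
    rcases lt_trichotomy (f (g c)) c with h | h | h
    · have := ih _ h (by rw [hf.involutive]; exact hb)
      rw [hf.involutive] at this
      have h' := g.injective this
      exact h.ne h'
    · have h' := congrArg f h
      rw [hf.involutive] at h'
      exact hlt.ne h'.symm
    · refine hf.not_crossing (i := f c) (j := g c) hlt ?_ ?_ <;> rw [hf.involutive]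
      · exact hgc
      · exact h
  have hclose : ∀ c, f c < c → g c = f c := by
    intro c
    induction c using WellFoundedLT.induction with
    | ind c ih =>
      intro hc
      have hc' := (h1 c).1 hc
      rcases lt_trichotomy (f c) (g c) with h | h | h
      · exact absurd h (key hf hg h2 c hc hc' ih)
      · exact h.symm
      · refine absurd h (key hg hf (fun i => (h2 i).symm) c hc' hc ?_)
        exact fun e he hge => (ih e he ((h1 e).2 hge)).symm
  ext i
  congr 1
  rcases lt_trichotomy (f i) i with h | h | h
  · exact (hclose i h).symm
  · have h3 : ¬ g i < i := fun h' => ((h1 i).2 h').ne h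
    have h4 : ¬ i < g i := fun h' => ((h2 i).2 h').ne' h
    rw [h]
    exact le_antisymm (not_lt.1 h3) (not_lt.1 h4)
  · have := hclose (f i) (by rw [hf.involutive]; exact h)
    rw [hf.involutive] at this
    rw [← this, hg.involutive, this]

theorem card_le (N : ℕ) : Nat.card {f : Equiv.Perm (Fin N) // IsPlanarInvolution f} ≤ 4 ^ N := by
  classical
  have : Nat.card (Fin N → Bool × Bool) = 4 ^ N := by simp
  rw [← this]
  refine Nat.card_le_card_of_injective (fun f i => (decide (f.1 i < i), decide (i < f.1 i))) ?_
  intro f g h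
  apply Subtype.ext
  apply f.2.eq_of_lt_iff g.2
  · intro i
    simpa using congrArg Prod.fst (congrFun h i)
  · intro i
    simpa using congrArg Prod.snd (congrFun h i)

end IsPlanarInvolution

/-! ### Encoding connected graphs and the exponential upper bound. -/

theorem exists_equiv_finRotate {X : Type*} [Finite X] [Nonempty X] (s : Equiv.Perm X)
    (hs : numCycles s = 1) {N : ℕ} (hN : Nat.card X = N) :
    ∃ e : Fin N ≃ X, ∀ i, e (finRotate _ i) = s (e i) := by
  classical
  subst hN
  have := Fintype.ofFinite X
  have hsub : Subsingleton (Quotient (SameCycle.setoid s)) :=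
    (Nat.card_eq_one_iff_unique.1 hs).1
  have hall : ∀ x y, s.SameCycle x y := fun x y =>
    Quotient.exact (hsub.elim (Quotient.mk (SameCycle.setoid s) x) (Quotient.mk _ y))
  have hcyc : s.IsCycleOn (Finset.univ : Finset X) :=
    ⟨by simp, fun x _ y _ => hall x y⟩
  obtain ⟨x⟩ := ‹Nonempty X›
  have hcard : Nat.card X = (Finset.univ : Finset X).card := by
    rw [Nat.card_eq_fintype_card, Finset.card_univ]
  have hsurj : Function.Surjective fun i : Fin (Nat.card X) => (s ^ (i : ℕ)) x := fun y => by
    obtain ⟨n, hn, hy⟩ := hcyc.exists_pow_eq (Finset.mem_univ x) (Finset.mem_univ y)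
    exact ⟨⟨n, hcard ▸ hn⟩, hy⟩
  have hbij := (Nat.bijective_iff_surjective_and_card _).2 ⟨hsurj, Nat.card_fin _⟩
  refine ⟨Equiv.ofBijective _ hbij, fun i => ?_⟩
  change (s ^ (finRotate _ i : ℕ)) x = s ((s ^ (i : ℕ)) x)
  rw [← mul_apply, ← pow_succ']
  by_cases hi : (i : ℕ) + 1 < Nat.card X
  · rw [val_finRotate_of_lt (k := ⟨i + 1, hi⟩) (by rw [Fin.lt_def]; exact Nat.lt_succ_self _)]
  · have h1 : (i : ℕ) + 1 = Nat.card X := by have := i.2; omega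
    have h2 : ((finRotate _ i : Fin (Nat.card X)) : ℕ) = 0 := by
      generalize Nat.card X = N at i h1
      obtain _ | n := N
      · exact i.elim0
      · obtain rfl : i = Fin.last n := Fin.ext (by simpa using h1)
        simp
    rw [h2, h1, hcard, hcyc.pow_card_apply (Finset.mem_univ x), pow_zero, one_apply]

theorem IsRegularPlanar.card_darts {V X : Type} [Finite V] [Finite X] {D : ℕ} {G : SimpleGraph V}
    (M : DartModel G X) (hdeg : ∀ v, Nat.card (G.neighborSet v) = D) :
    Nat.card X = D * Nat.card V := by
  have := Fintype.ofFinite V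
  rw [← Nat.card_congr (Equiv.sigmaFiberEquiv M.tail), Nat.card_sigma]
  simp only [← M.card_neighborSet, hdeg, Finset.sum_const, smul_eq_mul, Finset.card_univ]
  rw [Nat.card_eq_fintype_card, mul_comm]

theorem Equiv.Perm.numMoved_eq_of_semiconj {X Y : Type*} {f : Equiv.Perm X} {g : Equiv.Perm Y}
    (e : Y ≃ X) (hfg : ∀ y, e (g y) = f (e y)) : numMoved g = numMoved f := by
  rw [numMoved, numMoved, ← Set.ncard_image_of_injective _ e.injective]
  congr 1
  ext x
  obtain ⟨y, rfl⟩ := e.surjective x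
  rw [e.injective.mem_set_image, Set.mem_ofPred_eq, Set.mem_ofPred_eq, ← hfg, e.injective.ne_iff]

theorem Equiv.Perm.involutive_mul_of_partial {X : Type*} {t f : Equiv.Perm X}
    (hf : ∀ x, f (f x) = x) (hf' : ∀ x, f x ≠ x) (ht : ∀ x, t (t x) = x)
    (htf : ∀ x, t x = x ∨ t x = f x) (x : X) :
    (t * f) ((t * f) x) = x ∧ ((t * f) x ≠ x ↔ t x = x) := by
  simp only [mul_apply]
  have h1 := htf x
  have h2 := htf (f x)
  have h3 := ht x
  have h4 := ht (f x)
  have h5 := hf x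
  have h6 := hf' x
  have h7 := hf' (f x)
  grind

/-- A connected regular planar graph is encoded by two planar involutions and a labelling. -/
theorem IsRegularPlanar.exists_code {n D : ℕ} {G : SimpleGraph (Fin n)}
    (hG : IsRegularPlanar D G) (hc : G.Connected) :
    ∃ (f g : Equiv.Perm (Fin (D * n))) (w : Fin (D * n) → Fin n), IsPlanarInvolution f ∧
      IsPlanarInvolution g ∧ numCycles (finRotate (D * n) * f) = n ∧
      (∀ i, w (finRotate (D * n) (f i)) = w i) ∧
      ∀ a b, G.Adj a b ↔ ∃ i, w i = a ∧ w (f (g i)) = b := by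
  classical
  obtain ⟨⟨X, hX, M, hM⟩, hdeg⟩ := hG
  have hcard := IsRegularPlanar.card_darts M hdeg
  rw [Nat.card_fin] at hcard
  have hne : Nonempty X := by
    obtain ⟨v⟩ := hc.nonempty
    obtain ⟨x, -⟩ := M.tail_surjective v
    exact ⟨x⟩
  -- Here `t` reverses the darts of a spanning tree and `M.rot * t` walks once around it. In that
  -- cyclic order `f` is the tree and `g` the remaining edges. Rotation is the polygon's rotation
  -- times `f`, and reversal is `f * g`. Planarity of `g` is the Euler relation with the tree's
  -- share subtracted.
  obtain ⟨t, ht, ht', hcyc, hmoved⟩ := exists_tree_involution M.rot M.rev M.rev_rev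
    fun r h1 h2 x y => M.setoid_of_reachable h1 h2 (hc.preconnected _ _)
  obtain ⟨e, he⟩ := exists_equiv_finRotate (M.rot * t) hcyc hcard
  let f : Equiv.Perm (Fin (D * n)) := e.trans (t.trans e.symm)
  let g : Equiv.Perm (Fin (D * n)) := e.trans ((t * M.rev).trans e.symm)
  have hf : ∀ i, e (f i) = t (e i) := fun i => e.apply_symm_apply _
  have hg : ∀ i, e (g i) = (t * M.rev) (e i) := fun i => e.apply_symm_apply _
  have hpart := Equiv.Perm.involutive_mul_of_partial M.rev_rev M.rev_ne ht ht'
  have hcf : numCycles M.rot = numCycles (finRotate (D * n) * f) :=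
    numCycles_eq_of_semiconj e fun i => by rw [mul_apply, he, hf, mul_apply, ht]
  have hcg : numCycles (M.rot * M.rev) = numCycles (finRotate (D * n) * g) :=
    numCycles_eq_of_semiconj e fun i => by
      rw [mul_apply, he, hg, mul_apply, mul_apply, ht, mul_apply]
  have hmf := numMoved_eq_of_semiconj e hf
  have hmg := numMoved_eq_of_semiconj e hg
  have hrot := M.numCycles_rot
  rw [Nat.card_fin] at hrot
  have hsum : numMoved (t * M.rev) + numMoved t = D * n := by
    have : {x | (t * M.rev) x ≠ x} = {x | t x ≠ x}ᶜ := by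
      ext x
      simpa using (hpart x).2
    rw [numMoved, numMoved, this, ← hcard, add_comm]
    exact Set.ncard_add_ncard_compl _
  have hcomp : Nat.card G.ConnectedComponent = 1 := by
    have := hc.nonempty
    exact Nat.card_eq_one_iff_unique.2 ⟨hc.preconnected.subsingleton_connectedComponent,
      ⟨G.connectedComponentMk (Classical.arbitrary _)⟩⟩
  rw [DartModel.Spherical, DartModel.numFaces, hcomp, Nat.card_fin, hcard] at hM
  refine ⟨f, g, fun i => M.tail (e i), ⟨fun i => ?_, by omega⟩, ⟨fun i => ?_, by omega⟩, by omega,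
    fun i => ?_, fun a b => ?_⟩
  · exact e.injective (by rw [hf, hf, ht])
  · exact e.injective (by rw [hg, hg, (hpart _).1])
  · simp only [he, hf, mul_apply, ht, M.tail_rot]
  · rw [M.adj_iff]
    constructor
    · rintro ⟨x, rfl, rfl⟩
      exact ⟨e.symm x, by simp, by simp [hf, hg, ht]⟩
    · rintro ⟨i, rfl, rfl⟩
      exact ⟨e i, rfl, by simp [hf, hg, ht]⟩

/-- The labelling is constant on the `n` cycles that represent vertices, so it costs only `n ^ n`,
which is within an exponential factor of `n!`. -/
theorem numConnected_le (D n : ℕ) :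
    numConnected D (Fin n) ≤ 4 ^ (D * n) * (n ^ n * 4 ^ (D * n)) := by
  classical
  let N := D * n
  let T := Σ f : {f : Equiv.Perm (Fin N) // IsPlanarInvolution f ∧
      numCycles (finRotate N * f) = n},
    (Quotient (SameCycle.setoid (finRotate N * f.1)) → Fin n) ×
      {g : Equiv.Perm (Fin N) // IsPlanarInvolution g}
  have hT : Nat.card T ≤ 4 ^ N * (n ^ n * 4 ^ N) := by
    rw [Nat.card_sigma]
    have hle : ∀ f : {f : Equiv.Perm (Fin N) // IsPlanarInvolution f ∧
        numCycles (finRotate N * f) = n},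
        Nat.card ((Quotient (SameCycle.setoid (finRotate N * f.1)) → Fin n) ×
          {g : Equiv.Perm (Fin N) // IsPlanarInvolution g}) ≤ n ^ n * 4 ^ N := by
      rintro ⟨f, hf, hf'⟩
      rw [Nat.card_prod, Nat.card_fun, Nat.card_fin]
      rw [numCycles] at hf'
      rw [hf']
      exact Nat.mul_le_mul_left _ (IsPlanarInvolution.card_le N)
    refine (Finset.sum_le_sum fun f _ => hle f).trans ?_
    rw [Finset.sum_const, smul_eq_mul, Finset.card_univ, ← Nat.card_eq_fintype_card]
    refine Nat.mul_le_mul_right _ (le_trans ?_ (IsPlanarInvolution.card_le N))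
    exact Nat.card_le_card_of_injective (fun f => ⟨f.1, f.2.1⟩) fun f g h =>
      Subtype.ext (Subtype.mk.inj h)
  refine le_trans ?_ hT
  have hex : ∀ G : {G : SimpleGraph (Fin n) // IsRegularPlanar D G ∧ G.Connected}, ∃ t : T,
      ∀ a b, G.1.Adj a b ↔ ∃ i, t.2.1 (Quotient.mk _ i) = a ∧
        t.2.1 (Quotient.mk _ (t.1.1 (t.2.2.1 i))) = b := by
    rintro ⟨G, hG, hc⟩
    obtain ⟨f, g, w, hf, hg, hn, hw, hadj⟩ := hG.exists_code hc
    have hle : SameCycle.setoid (finRotate N * f) ≤ Setoid.ker w :=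
      setoid_le_of_apply fun i => (hw i).symm
    exact ⟨⟨⟨f, hf, hn⟩, Quotient.lift w fun a b h => hle h, ⟨g, hg⟩⟩, hadj⟩
  choose F hF using hex
  refine Nat.card_le_card_of_injective F fun G H h => Subtype.ext ?_
  ext a b
  rw [hF G, hF H, h]

/-! ### Fekete's lemma with an error term and the transfer of growth rates. -/

section Analysis

/-- A balanced split increases the sum of square roots by a factor of at least 6/5. Hence a
correction of `5 * C * √n` gains the `C * √n` that absorbs the error of one subadditivity step. -/
theorem sqrt_add_le_of_balanced {a b : ℝ} (ha : 0 ≤ a) (hab : a ≤ b) (h : b ≤ 2 * a) :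
    6 * √(a + b) ≤ 5 * (√a + √b) := by
  have hb : 0 ≤ b := ha.trans hab
  have h1 := Real.sq_sqrt ha
  have h2 := Real.sq_sqrt hb
  have h3 := Real.sqrt_le_sqrt hab
  have h4 := Real.sqrt_nonneg a
  have h5 : √(a + b) ≤ 5 / 6 * (√a + √b) := by
    rw [Real.sqrt_le_iff]
    refine ⟨by positivity, ?_⟩
    nlinarith
  linarith

theorem almost_subadditive_mul_le {u : ℕ → ℝ} {n₀ : ℕ} {C : ℝ} (hC : 0 ≤ C)
    (h : ∀ m n, n₀ ≤ m → n₀ ≤ n → u (m + n) ≤ u m + u n + C * √((m + n : ℕ) : ℝ)) {n : ℕ}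
    (hn : n₀ ≤ n) (k : ℕ) (hk : 1 ≤ k) :
    u (k * n) ≤ k * (u n + 5 * C * √(n : ℝ)) - 5 * C * √((k * n : ℕ) : ℝ) := by
  induction k using Nat.strong_induction_on with
  | _ k ih =>
    rcases hk.eq_or_lt with rfl | hk
    · simp
    obtain ⟨a, b, rfl, ha, hab, hba⟩ : ∃ a b, k = a + b ∧ 1 ≤ a ∧ a ≤ b ∧ b ≤ 2 * a :=
      ⟨k / 2, k - k / 2, by omega, by omega, by omega, by omega⟩
    have ha' := ih a (by omega) ha
    have hb' := ih b (by omega) (by omega)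
    have hsub := h (a * n) (b * n) (by nlinarith) (by nlinarith)
    rw [← add_mul] at hsub
    have hsq := sqrt_add_le_of_balanced (a := ((a * n : ℕ) : ℝ)) (b := ((b * n : ℕ) : ℝ))
      (by positivity) (by exact_mod_cast Nat.mul_le_mul_right n hab)
      (by
        have := Nat.mul_le_mul_right n hba
        rw [mul_assoc] at this
        exact_mod_cast this)
    rw [← Nat.cast_add, ← add_mul] at hsq
    have := mul_le_mul_of_nonneg_left hsq hC
    push_cast at *
    linarith

/-- Fekete's lemma with a sublinear error term. -/
theorem exists_tendsto_div_of_almost_subadditive {u : ℕ → ℝ} {n₀ : ℕ} {B C : ℝ} (hn₀ : 1 ≤ n₀)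
    (hC : 0 ≤ C)
    (h : ∀ m n, n₀ ≤ m → n₀ ≤ n → u (m + n) ≤ u m + u n + C * √((m + n : ℕ) : ℝ))
    (hB : ∀ n, n₀ ≤ n → B * n ≤ u n) : ∃ L, Tendsto (fun n : ℕ => u n / n) atTop (𝓝 L) := by
  -- The limit is the infimum of this corrected quotient over `n ≥ n₀`.
  let g : ℕ → ℝ := fun n => u n / n + 5 * C / √(n : ℝ)
  let s : Set ℝ := g '' {n | n₀ ≤ n}
  have hbdd : BddBelow s := by
    refine ⟨B, ?_⟩
    rintro _ ⟨n, hn, rfl⟩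
    have hn' : n₀ ≤ n := hn
    have hpos : (0 : ℝ) < n := by exact_mod_cast (show 0 < n by omega)
    have h1 : B ≤ u n / n := by rw [le_div_iff₀ hpos]; exact hB n hn
    have h2 : 0 ≤ 5 * C / √(n : ℝ) := by positivity
    change B ≤ u n / n + 5 * C / √(n : ℝ)
    linarith
  have hne : s.Nonempty := ⟨g n₀, n₀, le_refl n₀, rfl⟩
  have hsqrt : Tendsto (fun n : ℕ => √(n : ℝ)) atTop atTop :=
    Real.tendsto_sqrt_atTop.comp tendsto_natCast_atTop_atTop
  refine ⟨sInf s, tendsto_order.2 ⟨fun a ha => ?_, fun a ha => ?_⟩⟩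
  · have hlim : Tendsto (fun n : ℕ => sInf s - 5 * C / √(n : ℝ)) atTop (𝓝 (sInf s - 0)) :=
      tendsto_const_nhds.sub (hsqrt.const_div_atTop _)
    rw [sub_zero] at hlim
    filter_upwards [(tendsto_order.1 hlim).1 a ha, eventually_ge_atTop n₀] with n hn hn'
    have : sInf s ≤ g n := csInf_le hbdd ⟨n, hn', rfl⟩
    change sInf s ≤ u n / n + 5 * C / √(n : ℝ) at this
    linarith
  · obtain ⟨_, ⟨n, hn, rfl⟩, hga⟩ := exists_lt_of_csInf_lt hne ha
    have hn' : n₀ ≤ n := hn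
    have hpos : (0 : ℝ) < n := by exact_mod_cast (show 0 < n by omega)
    obtain ⟨K, hK⟩ : ∃ K, ∀ r < 2 * n, u r ≤ K :=
      ⟨∑ r ∈ Finset.range (2 * n), |u r|, fun r hr => (le_abs_self _).trans
        (Finset.single_le_sum (f := fun r => |u r|) (fun _ _ => abs_nonneg _)
          (Finset.mem_range.2 hr))⟩
    have hlim : Tendsto (fun N : ℕ => g n + (K + 2 * n * |g n|) / (N : ℝ) + C / √(N : ℝ)) atTop
        (𝓝 (g n + 0 + 0)) :=
      (tendsto_const_nhds.add (tendsto_natCast_atTop_atTop.const_div_atTop _)).add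
        (hsqrt.const_div_atTop _)
    rw [add_zero, add_zero] at hlim
    filter_upwards [(tendsto_order.1 hlim).2 a hga, eventually_ge_atTop (2 * n)] with N hN hN'
    refine lt_of_le_of_lt ?_ hN
    have hNpos : (0 : ℝ) < N := by exact_mod_cast (show 0 < N by omega)
    -- The remainder is kept in `[n, 2n)` rather than `[0, n)`, since subadditivity needs both
    -- summands to be at least `n₀`.
    obtain ⟨k, r, hk, hr, hr', hkr⟩ : ∃ k r, 1 ≤ k ∧ n ≤ r ∧ r < 2 * n ∧ N = k * n + r := by
      have hdiv : 2 ≤ N / n := (Nat.le_div_iff_mul_le (by omega)).2 hN'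
      have hmod := Nat.mod_lt N (show 0 < n by omega)
      refine ⟨N / n - 1, N % n + n, by omega, by omega, by omega, ?_⟩
      have := Nat.div_add_mod' N n
      obtain ⟨q, hq⟩ : ∃ q, N / n = q + 1 := ⟨N / n - 1, by omega⟩
      rw [hq] at this ⊢
      rw [Nat.add_sub_cancel]
      linarith
    have h1 := almost_subadditive_mul_le hC h hn' k hk
    have h2 := h (k * n) r (hn'.trans (Nat.le_mul_of_pos_left n hk)) (hn'.trans hr)
    rw [← hkr] at h2
    have h3 := hK r hr'
    have h4 : 0 ≤ 5 * C * √((k * n : ℕ) : ℝ) := by positivity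
    have h5 : (k : ℝ) * (u n + 5 * C * √(n : ℝ)) = (N - r : ℝ) * g n := by
      have hs : √(n : ℝ) ≠ 0 := (Real.sqrt_pos.2 hpos).ne'
      have hs' : √(n : ℝ) * √(n : ℝ) = n := Real.mul_self_sqrt hpos.le
      have : (N : ℝ) - r = k * n := by rw [hkr]; push_cast; ring
      rw [this]
      change _ = k * n * (u n / n + 5 * C / √(n : ℝ))
      field_simp
      linear_combination 5 * C * hs'
    have h6 : -(r * g n) ≤ 2 * n * |g n| := by
      have h7 := neg_abs_le (g n)
      have h8 : (r : ℝ) ≤ 2 * n := by exact_mod_cast hr'.le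
      have h9 := abs_nonneg (g n)
      have h10 : (0 : ℝ) ≤ r := by positivity
      nlinarith
    have h7 : u N ≤ N * g n + (K + 2 * n * |g n|) + C * √(N : ℝ) := by
      rw [h5] at h1
      linarith
    rw [div_le_iff₀ hNpos]
    have h9 : C / √(N : ℝ) * N = C * √(N : ℝ) := by
      rw [div_mul_eq_mul_div, mul_div_assoc, Real.div_sqrt]
    rw [add_mul, add_mul, h9, div_mul_cancel₀ _ hNpos.ne']
    linarith

/-- An exponential bound for a sequence that is dominated by an "exponential formula". -/
theorem exists_le_mul_pow_of_recursion {a b : ℕ → ℝ} {B ρ ρ' : ℝ} (ha : ∀ n, 0 ≤ a n)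
    (hrec : ∀ n : ℕ, n * a n ≤ ∑ k ∈ Finset.range (n + 1), k * b k * a (n - k))
    (hρ : 0 < ρ) (hρ' : ρ < ρ') (hB : 0 ≤ B) (hb : ∀ n, b n ≤ B * ρ ^ n) :
    ∃ K, 0 < K ∧ ∀ n, a n ≤ K * ρ' ^ n := by
  have hρ'0 : 0 < ρ' := hρ.trans hρ'
  set q := ρ / ρ' with hq
  have hq0 : 0 ≤ q := by positivity
  have hq1 : q < 1 := (div_lt_one hρ'0).2 hρ'
  have hsum : Summable fun k : ℕ => (k : ℝ) * q ^ k := by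
    have := summable_pow_mul_geometric_of_norm_lt_one 1
      (show ‖q‖ < 1 by rwa [Real.norm_of_nonneg hq0])
    simpa using this
  set S := ∑' k : ℕ, (k : ℝ) * q ^ k with hS
  -- Beyond `n₁` the factor `n` on the left of the recursion dominates `B * S`, so the induction
  -- keeps the same constant `K`. Earlier terms are built into `K`.
  obtain ⟨n₁, hn₁⟩ := exists_nat_ge (B * S)
  let K : ℝ := 1 + ∑ n ∈ Finset.range (n₁ + 1), a n / ρ' ^ n
  have hK : 0 < K := by
    have : 0 ≤ ∑ n ∈ Finset.range (n₁ + 1), a n / ρ' ^ n :=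
      Finset.sum_nonneg fun n _ => div_nonneg (ha n) (by positivity)
    change 0 < 1 + _
    linarith
  refine ⟨K, hK, fun n => ?_⟩
  induction n using Nat.strong_induction_on with
  | _ n ih =>
    by_cases hn : n ≤ n₁
    · rw [← div_le_iff₀ (by positivity)]
      have := Finset.single_le_sum (f := fun n => a n / ρ' ^ n)
        (fun n _ => div_nonneg (ha n) (by positivity)) (Finset.mem_range.2 (Nat.lt_succ_of_le hn))
      change _ ≤ 1 + _
      linarith
    · have hnpos : (0 : ℝ) < n := by exact_mod_cast (show 0 < n by omega)
      have hterm : ∀ k ∈ Finset.range (n + 1), (k : ℝ) * b k * a (n - k) ≤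
          B * K * ρ' ^ n * (k * q ^ k) := by
        intro k hk
        rw [Finset.mem_range] at hk
        rcases Nat.eq_zero_or_pos k with rfl | hkpos
        · simp
        have h1 := ih (n - k) (by omega)
        have h2 : (k : ℝ) * b k ≤ k * (B * ρ ^ k) := mul_le_mul_of_nonneg_left (hb k) (by positivity)
        calc (k : ℝ) * b k * a (n - k) ≤ k * (B * ρ ^ k) * a (n - k) :=
              mul_le_mul_of_nonneg_right h2 (ha _)
          _ ≤ k * (B * ρ ^ k) * (K * ρ' ^ (n - k)) :=
              mul_le_mul_of_nonneg_left h1 (by positivity)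
          _ = B * K * ρ' ^ n * (k * q ^ k) := by
              have : ρ' ^ n = ρ' ^ (n - k) * ρ' ^ k := by
                rw [← pow_add, Nat.sub_add_cancel (by omega)]
              rw [this, hq, div_pow]
              field_simp
      have h3 : (n : ℝ) * a n ≤ B * K * ρ' ^ n * S := by
        refine (hrec n).trans ((Finset.sum_le_sum hterm).trans ?_)
        rw [← Finset.mul_sum]
        refine mul_le_mul_of_nonneg_left ?_ (by positivity)
        exact hsum.sum_le_tsum _ fun k _ => by positivity
      have h4 : B * K * ρ' ^ n * S ≤ n * (K * ρ' ^ n) := by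
        have h5 : B * S ≤ n := hn₁.trans (by exact_mod_cast (not_le.1 hn).le)
        have h6 : 0 ≤ K * ρ' ^ n := by positivity
        nlinarith
      exact le_of_mul_le_mul_left (h3.trans h4) hnpos

/-- The lower bound is `b ≤ a`. Above, for `γ < ρ < ρ' < c`, the bound `b n ≤ B * ρ ^ n` gives `a n
≤ K * ρ' ^ n`, and the root of `K` tends to 1. Vanishing at odd indices supplies the bound on `b`
there. -/
theorem tendsto_root_of_recursion {a b : ℕ → ℝ} {γ : ℝ} (hb0 : ∀ n, 0 ≤ b n)
    (hba : ∀ n, b n ≤ a n)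
    (hrec : ∀ n : ℕ, n * a n ≤ ∑ k ∈ Finset.range (n + 1), k * b k * a (n - k))
    (hodd : ∀ n, ¬ Even n → b n = 0) (hγ : 0 < γ)
    (hb : Tendsto (fun n : ℕ => b (2 * n) ^ (1 / (2 * n : ℝ))) atTop (𝓝 γ)) :
    Tendsto (fun n : ℕ => a (2 * n) ^ (1 / (2 * n : ℝ))) atTop (𝓝 γ) := by
  have ha0 : ∀ n, 0 ≤ a n := fun n => (hb0 n).trans (hba n)
  refine tendsto_order.2 ⟨fun c hc => ?_, fun c hc => ?_⟩
  · filter_upwards [(tendsto_order.1 hb).1 c hc] with n hn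
    exact hn.trans_le (Real.rpow_le_rpow (hb0 _) (hba _) (by positivity))
  · obtain ⟨ρ', h1, h2⟩ := exists_between hc
    obtain ⟨ρ, h3, h4⟩ := exists_between h1
    have hρ : 0 < ρ := hγ.trans h3
    have hρ' : 0 < ρ' := hρ.trans h4
    have hev : ∀ᶠ n : ℕ in atTop, b n / ρ ^ n ≤ 1 := by
      obtain ⟨n₁, hn₁⟩ := eventually_atTop.1 ((tendsto_order.1 hb).2 ρ h3)
      filter_upwards [eventually_ge_atTop (2 * n₁ + 1)] with n hn
      rw [div_le_one (by positivity)]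
      by_cases hev : Even n
      · obtain ⟨k, rfl⟩ := hev
        rw [← two_mul] at hn ⊢
        have hk := hn₁ k (by omega)
        have hkpos : 0 < 2 * k := by omega
        have := pow_le_pow_left₀ (Real.rpow_nonneg (hb0 _) _) hk.le (2 * k)
        rwa [← Real.rpow_natCast, ← Real.rpow_mul (hb0 _), Nat.cast_mul, Nat.cast_two,
          one_div_mul_cancel (by exact_mod_cast hkpos.ne'), Real.rpow_one] at this
      · rw [hodd n hev]; positivity
    obtain ⟨B, hB⟩ := (Filter.isBoundedUnder_of_eventually_le hev).bddAbove_range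
    have hB' : ∀ n, b n ≤ |B| * ρ ^ n := fun n => by
      rw [← div_le_iff₀ (by positivity)]
      exact (hB ⟨n, rfl⟩).trans (le_abs_self B)
    obtain ⟨K, hK, hKa⟩ := exists_le_mul_pow_of_recursion ha0 hrec hρ h4 (abs_nonneg B) hB'
    have hinv : Tendsto (fun n : ℕ => 1 / (2 * n : ℝ)) atTop (𝓝 0) :=
      (tendsto_natCast_atTop_atTop.const_mul_atTop two_pos).const_div_atTop 1
    have hlim : Tendsto (fun n : ℕ => K ^ (1 / (2 * n : ℝ)) * ρ') atTop (𝓝 (K ^ (0 : ℝ) * ρ')) :=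
      ((Real.continuousAt_const_rpow hK.ne').tendsto.comp hinv).mul_const _
    rw [Real.rpow_zero, one_mul] at hlim
    filter_upwards [(tendsto_order.1 hlim).2 c h2, eventually_gt_atTop 0] with n hn hn'
    refine lt_of_le_of_lt ?_ hn
    refine (Real.rpow_le_rpow (ha0 _) (hKa _) (by positivity)).trans_eq ?_
    have hn2 : (0 : ℝ) < n := by exact_mod_cast hn'
    rw [Real.mul_rpow hK.le (by positivity), ← Real.rpow_natCast, ← Real.rpow_mul hρ'.le,
      Nat.cast_mul, Nat.cast_two, mul_one_div_cancel (by positivity), Real.rpow_one]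

end Analysis

/-! ### Existence of the limits, given connected graphs of all large even orders. -/

theorem ncard_boundedDegreePlanarGraphs {D : ℕ} (hD : 1 ≤ D) (n : ℕ) :
    (boundedDegreePlanarGraphs n D D).ncard = numRegular D (Fin n) := by
  classical
  have key : boundedDegreePlanarGraphs n D D = {G : SimpleGraph (Fin n) | IsRegularPlanar D G} := by
    ext G
    have hdeg : (∀ v, D ≤ Nat.card (G.neighborSet v) ∧ Nat.card (G.neighborSet v) ≤ D) ↔
        ∀ v, Nat.card (G.neighborSet v) = D :=
      forall_congr' fun v => ⟨fun h => le_antisymm h.2 h.1, fun h => ⟨h.ge, h.le⟩⟩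
    have hcard : ∀ v, G.degree v = Nat.card (G.neighborSet v) := fun v => by
      rw [Nat.card_eq_fintype_card, SimpleGraph.card_neighborSet_eq_degree]
    have hmem : G ∈ boundedDegreePlanarGraphs n D D ↔
        IsPlanarGraph G ∧ ∀ v, D ≤ Nat.card (G.neighborSet v) ∧ Nat.card (G.neighborSet v) ≤ D := by
      simp only [← hcard]
      rw [boundedDegreePlanarGraphs]
      refine and_congr_right fun _ => forall_congr' fun v => ?_
      convert Iff.rfl
    rw [hmem, hdeg]
    refine and_congr_left fun h => ?_
    constructor
    · rintro ⟨R, hR⟩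
      have hadj : ∀ v, ∃ w, G.Adj v w := fun v => by
        have : 0 < Nat.card (G.neighborSet v) := by rw [h v]; omega
        obtain ⟨⟨w, hw⟩⟩ := (Nat.card_pos_iff.1 this).1
        exact ⟨w, hw⟩
      exact ⟨G.Dart, inferInstance, DartModel.ofRotationSystem R hadj,
        DartModel.ofRotationSystem_spherical hadj hR⟩
    · rintro ⟨X, hX, M, hM⟩
      exact M.isPlanarGraph hM
  rw [key]
  rfl

theorem IsRegularPlanar.even_mul {n D : ℕ} {G : SimpleGraph (Fin n)} (hG : IsRegularPlanar D G) :
    Even (D * n) := by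
  obtain ⟨⟨X, hX, M, hM⟩, hdeg⟩ := hG
  have hcard := IsRegularPlanar.card_darts M hdeg
  rw [DartModel.Spherical, hcard, Nat.card_fin] at hM
  exact ⟨n + M.numFaces - 2 * Nat.card G.ConnectedComponent, by omega⟩

theorem numConnected_le_numRegular (D n : ℕ) :
    numConnected D (Fin n) ≤ numRegular D (Fin n) :=
  Nat.card_le_card_of_injective (fun G => ⟨G.1, G.2.1⟩) fun _ _ h => Subtype.ext (Subtype.mk.inj h)

theorem numConnected_div_factorial_le (D n : ℕ) :
    (numConnected D (Fin n) : ℝ) / n ! ≤ (16 ^ D * Real.exp 1) ^ n := by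
  have h1 : (numConnected D (Fin n) : ℝ) ≤ 4 ^ (D * n) * (n ^ n * 4 ^ (D * n)) := by
    exact_mod_cast numConnected_le D n
  have h2 : (n : ℝ) ^ n / n ! ≤ Real.exp n := Real.pow_div_factorial_le_exp _ (by positivity) n
  have h3 : (0 : ℝ) < n ! := by positivity
  rw [div_le_iff₀ h3] at h2 ⊢
  calc (numConnected D (Fin n) : ℝ) ≤ 4 ^ (D * n) * (n ^ n * 4 ^ (D * n)) := h1
    _ ≤ 4 ^ (D * n) * ((Real.exp n * n !) * 4 ^ (D * n)) := by gcongr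
    _ = (16 ^ D * Real.exp 1) ^ n * n ! := by
      rw [mul_pow, ← Real.exp_nat_mul, mul_one, ← pow_mul,
        show (16 : ℝ) = 4 * 4 by norm_num, mul_pow]
      ring

/-- The logarithm of the fourth-power loss in supermultiplicativity becomes the square-root error of
the Fekete lemma. -/
theorem four_mul_log_le {x : ℝ} (hx : 0 < x) : 4 * Real.log (2 * x) ≤ 12 * √x := by
  have h1 : 0 < √(2 * x) := Real.sqrt_pos.2 (by positivity)
  have h2 := Real.log_le_sub_one_of_pos h1
  rw [Real.log_sqrt (by positivity), Real.sqrt_mul (by norm_num)] at h2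
  have h3 : √2 ≤ 3 / 2 := by rw [Real.sqrt_le_iff]; norm_num
  have h4 := Real.sqrt_nonneg x
  nlinarith

theorem exists_tendsto_root_numConnected {D : ℕ} (hD : 2 ≤ D) {n₀ : ℕ} (hn₀ : 1 ≤ n₀)
    (hpos : ∀ k, n₀ ≤ k → 0 < numConnected D (Fin (2 * k))) :
    ∃ γ : ℝ, 0 < γ ∧ Tendsto (fun n : ℕ =>
      ((numConnected D (Fin (2 * n)) : ℝ) / (2 * n)!) ^ (1 / (2 * n : ℝ))) atTop (𝓝 γ) := by
  let w : ℕ → ℝ := fun n => (numConnected D (Fin (2 * n)) : ℝ) / (2 * n)!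
  have hw : ∀ n, n₀ ≤ n → 0 < w n := fun n hn => by
    have := hpos n hn
    change (0 : ℝ) < (numConnected D (Fin (2 * n)) : ℝ) / (2 * n)!
    positivity
  have hmul : ∀ m n, w m * w n ≤ (2 * ((m + n : ℕ) : ℝ)) ^ 4 * w (m + n) := by
    intro m n
    have h1 := choose_mul_numConnected_le hD (2 * m) (2 * n)
    rw [← mul_add] at h1
    have h2 := Nat.add_choose_mul_factorial_mul_factorial (2 * m) (2 * n)
    rw [← Nat.choose_symm_add, ← mul_add] at h2
    have h1' : ((2 * (m + n)).choose (2 * m) : ℝ) * (numConnected D (Fin (2 * m)) *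
        numConnected D (Fin (2 * n))) ≤ (2 * ((m + n : ℕ) : ℝ)) ^ 4 *
        numConnected D (Fin (2 * (m + n))) := by exact_mod_cast h1
    have h2' : ((2 * (m + n)).choose (2 * m) : ℝ) * (2 * m)! * (2 * n)! = (2 * (m + n))! := by
      exact_mod_cast h2
    change (numConnected D (Fin (2 * m)) : ℝ) / (2 * m)! * (numConnected D (Fin (2 * n)) / (2 * n)!)
      ≤ (2 * ((m + n : ℕ) : ℝ)) ^ 4 * (numConnected D (Fin (2 * (m + n))) / (2 * (m + n))!)
    rw [div_mul_div_comm, ← mul_div_assoc, div_le_div_iff₀ (by positivity) (by positivity), ← h2']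
    have h3 : (0 : ℝ) ≤ (2 * m)! * (2 * n)! := by positivity
    calc _ = ((2 * (m + n)).choose (2 * m) : ℝ) * (numConnected D (Fin (2 * m)) *
        numConnected D (Fin (2 * n))) * ((2 * m)! * (2 * n)!) := by ring
      _ ≤ _ := mul_le_mul_of_nonneg_right h1' h3
  obtain ⟨L, hL⟩ := exists_tendsto_div_of_almost_subadditive (u := fun n => -Real.log (w n))
    (n₀ := n₀) (C := 12) (B := -(2 * Real.log (16 ^ D * Real.exp 1))) hn₀ (by norm_num)
    (fun m n hm hn => by
      have hm' := hw m hm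
      have hn' := hw n hn
      have hmn' := hw (m + n) (hm.trans (Nat.le_add_right _ _))
      have hp : (0 : ℝ) < ((m + n : ℕ) : ℝ) := by exact_mod_cast (show 0 < m + n by omega)
      have h1 := Real.log_le_log (mul_pos hm' hn') (hmul m n)
      rw [Real.log_mul hm'.ne' hn'.ne', Real.log_mul (by positivity) hmn'.ne', Real.log_pow] at h1
      have h2 := four_mul_log_le hp
      push_cast at *
      linarith)
    (fun n hn => by
      have h1 := Real.log_le_log (hw n hn) (numConnected_div_factorial_le D (2 * n))
      rw [Real.log_pow] at h1
      push_cast at h1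
      linarith)
  refine ⟨Real.exp (-L / 2), Real.exp_pos _, ?_⟩
  have hlim : Tendsto (fun n : ℕ => Real.exp (-(-Real.log (w n) / n) / 2)) atTop
      (𝓝 (Real.exp (-L / 2))) :=
    (Real.continuous_exp.tendsto _).comp (hL.neg.div_const 2)
  refine hlim.congr' ?_
  filter_upwards [eventually_ge_atTop n₀] with n hn
  have hn' : (n : ℝ) ≠ 0 := by exact_mod_cast (show n ≠ 0 by omega)
  change _ = w n ^ (1 / (2 * n : ℝ))
  rw [Real.rpow_def_of_pos (hw n hn)]
  congr 1
  field_simp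

theorem exists_tendsto_root_numRegular {D : ℕ} (hD : 2 ≤ D) (hodd : Odd D) {n₀ : ℕ} (hn₀ : 1 ≤ n₀)
    (hpos : ∀ k, n₀ ≤ k → 0 < numConnected D (Fin (2 * k))) :
    ∃ γ : ℝ, 0 < γ ∧ Tendsto (fun n : ℕ =>
      ((numRegular D (Fin (2 * n)) : ℝ) / (2 * n)!) ^ (1 / (2 * n : ℝ))) atTop (𝓝 γ) := by
  obtain ⟨γ, hγ, hlim⟩ := exists_tendsto_root_numConnected hD hn₀ hpos
  refine ⟨γ, hγ, tendsto_root_of_recursion (a := fun n => (numRegular D (Fin n) : ℝ) / n !)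
    (b := fun n => (numConnected D (Fin n) : ℝ) / n !) (fun n => by positivity) (fun n => ?_)
    (fun n => ?_) (fun n hn => ?_) hγ hlim⟩
  · have : (numConnected D (Fin n) : ℝ) ≤ numRegular D (Fin n) := by
      exact_mod_cast numConnected_le_numRegular D n
    gcongr
  · have h := mul_numRegular_le D n
    have h' : (n : ℝ) * numRegular D (Fin n) ≤ ∑ k ∈ Finset.range (n + 1),
        (n.choose k : ℝ) * (k * numConnected D (Fin k) * numRegular D (Fin (n - k))) := by
      exact_mod_cast h
    rw [← mul_div_assoc, div_le_iff₀ (by positivity), Finset.sum_mul]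
    refine h'.trans_eq (Finset.sum_congr rfl fun k hk => ?_)
    have hk' : k ≤ n := Nat.lt_succ_iff.1 (Finset.mem_range.1 hk)
    rw [Nat.cast_choose ℝ hk']
    field_simp
  · have : IsEmpty {G : SimpleGraph (Fin n) // IsRegularPlanar D G ∧ G.Connected} := by
      refine ⟨fun G => hn ?_⟩
      have := G.2.1.even_mul
      rw [Nat.even_mul] at this
      exact this.resolve_left (Nat.not_even_iff_odd.2 hodd)
    rw [numConnected, Nat.card_of_isEmpty]
    simp

theorem numConnected_add_pos {D : ℕ} (hD : 2 ≤ D) {m n : ℕ} (hm : 0 < numConnected D (Fin m))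
    (hn : 0 < numConnected D (Fin n)) : 0 < numConnected D (Fin (m + n)) := by
  have h1 := choose_mul_numConnected_le hD m n
  have h2 : 0 < (m + n).choose m := Nat.choose_pos (Nat.le_add_right m n)
  have h3 : 0 < (m + n).choose m * (numConnected D (Fin m) * numConnected D (Fin n)) := by
    positivity
  exact Nat.pos_of_ne_zero fun h => by rw [h, mul_zero] at h1; omega

/-! ### Explicit solids given by tables. -/

section Tables

variable {n d : ℕ}

/-- The entry of a table of darts, the dart `(v, i)` having the index `v * (d + 1) + i`. -/
def dartTable (l : List ℕ) (x : Fin (n + 1) × Fin (d + 1)) : Fin (n + 1) × Fin (d + 1) :=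
  (Fin.ofNat (n + 1) (l.getD (x.1 * (d + 1) + x.2) 0 / (d + 1)),
    -- `Fin.ofNat` reduces modulo `d + 1`, so this is the position of the dart at its vertex.
    Fin.ofNat (d + 1) (l.getD (x.1 * (d + 1) + x.2) 0))

/-- The cyclic order of the darts at every vertex. -/
def stdRot (n d : ℕ) : Equiv.Perm (Fin n × Fin d) :=
  Equiv.prodCongr (Equiv.refl _) (finRotate d)

theorem stdRot_sameCycle_iff (x y : Fin n × Fin (d + 1)) :
    (stdRot n (d + 1)).SameCycle x y ↔ x.1 = y.1 := by
  constructor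
  · intro h
    have hle : SameCycle.setoid (stdRot n (d + 1)) ≤ Setoid.ker Prod.fst :=
      setoid_le_of_apply fun _ => rfl
    exact hle h
  · have key : ∀ (v : Fin n) (i : Fin (d + 1)), (stdRot n (d + 1)).SameCycle (v, 0) (v, i) := by
      intro v i
      have hle : SameCycle.setoid (finRotate (d + 1)) ≤
          Setoid.comap (Prod.mk v) (SameCycle.setoid (stdRot n (d + 1))) :=
        setoid_le_of_apply fun j => sameCycle_apply_self (stdRot n (d + 1)) (v, j)
      exact hle (NoncrossingInvolution.sameCycle_finRotate d i)
    obtain ⟨v, i⟩ := x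
    obtain ⟨w, j⟩ := y
    rintro rfl
    exact (key v i).symm.trans (key v j)

/-- A connected regular planar graph given by the table `l` of dart reversal and the table `m` of
faces. -/
theorem numConnected_pos_of_table {F : ℕ}
    (hF : 2 * (n + 1) + 2 * (F + 1) = (n + 1) * (d + 1) + 4) (l m : List ℕ)
    (hrev : ∀ (v : Fin (n + 1)) (i : Fin (d + 1)), dartTable l (dartTable l (v, i)) = (v, i))
    (hloop : ∀ (v : Fin (n + 1)) (i : Fin (d + 1)), (dartTable l (v, i)).1 ≠ v)
    (hmult : ∀ (v : Fin (n + 1)) (i j : Fin (d + 1)),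
      (dartTable l (v, i)).1 = (dartTable l (v, j)).1 → i = j)
    (hface : ∀ (v : Fin (n + 1)) (i : Fin (d + 1)),
      m.getD ((dartTable l (v, i)).1 * (d + 1) + ((dartTable l (v, i)).2 + 1 : Fin (d + 1))) 0 =
        m.getD (v * (d + 1) + i) 0)
    (hsurj : ∀ f : Fin (F + 1), ∃ (v : Fin (n + 1)) (i : Fin (d + 1)),
      m.getD (v * (d + 1) + i) 0 = f)
    (hconn : ∀ v : Fin (n + 1), v ≠ 0 → ∃ i : Fin (d + 1), (dartTable l (v, i)).1 < v) :
    0 < numConnected (d + 1) (Fin (n + 1)) := by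
  let rev : Equiv.Perm (Fin (n + 1) × Fin (d + 1)) :=
    ⟨dartTable l, dartTable l, fun x => hrev x.1 x.2, fun x => hrev x.1 x.2⟩
  let G : SimpleGraph (Fin (n + 1)) :=
    { Adj := fun a b => ∃ x : Fin (n + 1) × Fin (d + 1), x.1 = a ∧ (rev x).1 = b
      symm := ⟨by
        rintro a b ⟨x, rfl, rfl⟩
        exact ⟨rev x, rfl, congrArg Prod.fst (hrev x.1 x.2)⟩⟩
      loopless := ⟨by
        rintro a ⟨x, rfl, h⟩
        exact hloop x.1 x.2 h⟩ }
  let M : DartModel G (Fin (n + 1) × Fin (d + 1)) :=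
    { rot := stdRot (n + 1) (d + 1)
      rev := rev
      tail := Prod.fst
      rev_rev := fun x => hrev x.1 x.2
      tail_eq_iff := fun x y => (stdRot_sameCycle_iff x y).symm
      tail_surjective := fun v => ⟨(v, 0), rfl⟩
      adj_iff := fun a b => Iff.rfl
      ext_tail := by
        rintro ⟨v, i⟩ ⟨w, j⟩ h h'
        obtain rfl : v = w := h
        rw [hmult v i j h'] }
  have hreach : ∀ v, G.Reachable v 0 := by
    intro v
    induction v using WellFoundedLT.induction with
    | ind v ih =>
      by_cases hv : v = 0
      · rw [hv]
      obtain ⟨i, hi⟩ := hconn v hv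
      exact (SimpleGraph.Adj.reachable (G := G) ⟨(v, i), rfl, rfl⟩).trans (ih _ hi)
  have hcon : G.Connected := (SimpleGraph.connected_iff _).2
    ⟨fun a b => (hreach a).trans (hreach b).symm, ⟨0⟩⟩
  have hcomp : Nat.card G.ConnectedComponent = 1 :=
    Nat.card_eq_one_iff_unique.2 ⟨hcon.preconnected.subsingleton_connectedComponent,
      ⟨G.connectedComponentMk 0⟩⟩
  -- The labels in `m` are constant on faces and take at least `F + 1` values. By Euler's inequality
  -- this lower bound suffices.
  have hfaces : F + 1 ≤ M.numFaces := by
    have h := card_le_numCycles (M.rot * M.rev)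
      (fun x => (⟨m.getD (x.1 * (d + 1) + x.2) 0,
        Set.mem_range_self x⟩ : Set.range fun x : Fin (n + 1) × Fin (d + 1) =>
          m.getD (x.1 * (d + 1) + x.2) 0)) (by rintro ⟨_, x, rfl⟩; exact ⟨x, rfl⟩)
      (fun x => Subtype.ext (by
        have := hface x.1 x.2
        rw [← finRotate_apply] at this
        exact this))
    refine le_trans ?_ h
    conv_lhs => rw [← Nat.card_fin (F + 1)]
    refine Nat.card_le_card_of_injective (fun f : Fin (F + 1) => ⟨(f : ℕ), ?_⟩) ?_
    · obtain ⟨v, i, h⟩ := hsurj f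
      exact ⟨(v, i), h⟩
    · intro f g h
      exact Fin.ext (Subtype.mk.inj h)
  have hM : M.Spherical := M.spherical_of_le (by
    rw [hcomp, Nat.card_prod, Nat.card_fin, Nat.card_fin]
    omega)
  have hdeg : ∀ v, Nat.card (G.neighborSet v) = d + 1 := by
    intro v
    rw [M.card_neighborSet]
    refine Eq.trans ?_ (Nat.card_fin (d + 1))
    exact Nat.card_congr
      { toFun := fun x => x.1.2
        invFun := fun i => ⟨(v, i), rfl⟩
        left_inv := by
          rintro ⟨⟨w, i⟩, h⟩
          obtain rfl : w = v := h
          rfl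
        right_inv := fun _ => rfl }
  exact Nat.card_pos_iff.2 ⟨⟨⟨G, ⟨⟨_, inferInstance, M, hM⟩, hdeg⟩, hcon⟩⟩, inferInstance⟩

/-- The tetrahedron. -/
theorem numConnected_three_four_pos : 0 < numConnected 3 (Fin 4) :=
  numConnected_pos_of_table (F := 3) (by norm_num)
    [3, 6, 9, 0, 11, 7, 1, 5, 10, 2, 8, 4]
    [0, 1, 2, 1, 0, 3, 2, 1, 3, 0, 2, 3]
    (by decide +kernel) (by decide +kernel) (by decide +kernel) (by decide +kernel)
    (by decide +kernel) (by decide +kernel)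

/-- The triangular prism. -/
theorem numConnected_three_six_pos : 0 < numConnected 3 (Fin 6) :=
  numConnected_pos_of_table (F := 4) (by norm_num)
    [7, 3, 9, 1, 6, 12, 4, 0, 15, 2, 14, 16, 5, 17, 10, 8, 11, 13]
    [0, 1, 2, 2, 1, 3, 3, 1, 0, 0, 2, 4, 2, 3, 4, 3, 0, 4]
    (by decide +kernel) (by decide +kernel) (by decide +kernel) (by decide +kernel)
    (by decide +kernel) (by decide +kernel)

/-- The icosahedron. -/
theorem numConnected_five_twelve_pos : 0 < numConnected 5 (Fin 12) :=
  numConnected_pos_of_table (F := 19) (by norm_num)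
    [5, 10, 15, 20, 25, 0, 29, 54, 30, 11, 1, 9, 34, 35, 16, 2, 14, 39, 40, 21, 3, 19, 44, 45,
      26, 4, 24, 49, 50, 6, 8, 53, 55, 36, 12, 13, 33, 59, 41, 17, 18, 38, 58, 46, 22, 23, 43,
      57, 51, 27, 28, 48, 56, 31, 7, 32, 52, 47, 42, 37]
    [0, 1, 2, 3, 4, 1, 0, 5, 6, 7, 2, 1, 7, 8, 9, 3, 2, 9, 10, 11, 4, 3, 11, 12, 13, 0, 4, 13,
      14, 5, 7, 6, 15, 16, 8, 9, 8, 16, 17, 10, 11, 10, 17, 18, 12, 13, 12, 18, 19, 14, 5, 14,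
      19, 15, 6, 16, 15, 19, 18, 17]
    (by decide +kernel) (by decide +kernel) (by decide +kernel) (by decide +kernel)
    (by decide +kernel) (by decide +kernel)

/-- Two icosahedra without a vertex, joined by five edges. -/
theorem numConnected_five_twentytwo_pos : 0 < numConnected 5 (Fin 22) :=
  numConnected_pos_of_table (F := 34) (by norm_num)
    [5, 10, 15, 20, 25, 0, 29, 54, 30, 11, 1, 9, 34, 35, 16, 2, 14, 39, 40, 21, 3, 19, 44, 45,
      26, 4, 24, 49, 50, 6, 8, 53, 55, 36, 12, 13, 33, 60, 41, 17, 18, 38, 65, 46, 22, 23, 43,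
      70, 51, 27, 28, 48, 75, 31, 7, 32, 79, 104, 80, 61, 37, 59, 84, 85, 66, 42, 64, 89, 90,
      71, 47, 69, 94, 95, 76, 52, 74, 99, 100, 56, 58, 103, 105, 86, 62, 63, 83, 109, 91, 67,
      68, 88, 108, 96, 72, 73, 93, 107, 101, 77, 78, 98, 106, 81, 57, 82, 102, 97, 92, 87]
    [0, 1, 2, 3, 4, 1, 0, 5, 6, 7, 2, 1, 7, 8, 9, 3, 2, 9, 10, 11, 4, 3, 11, 12, 13, 0, 4, 13,
      14, 5, 7, 6, 15, 16, 8, 9, 8, 16, 17, 10, 11, 10, 17, 18, 12, 13, 12, 18, 19, 14, 5, 14,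
      19, 15, 6, 16, 15, 20, 21, 22, 17, 16, 22, 23, 24, 18, 17, 24, 25, 26, 19, 18, 26, 27,
      28, 15, 19, 28, 29, 20, 22, 21, 30, 31, 23, 24, 23, 31, 32, 25, 26, 25, 32, 33, 27, 28,
      27, 33, 34, 29, 20, 29, 34, 30, 21, 31, 30, 34, 33, 32]
    (by decide +kernel) (by decide +kernel) (by decide +kernel) (by decide +kernel)
    (by decide +kernel) (by decide +kernel)

end Tables

/-! ### All large even orders, and the conclusion. -/

theorem numConnected_mul_pos {D n : ℕ} (hD : 2 ≤ D) (h : 0 < numConnected D (Fin n)) (k : ℕ) :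
    0 < numConnected D (Fin ((k + 1) * n)) := by
  induction k with
  | zero => rwa [zero_add, one_mul]
  | succ k ih => rw [add_mul _ 1, one_mul]; exact numConnected_add_pos hD ih h

theorem numConnected_three_pos (k : ℕ) (hk : 8 ≤ k) : 0 < numConnected 3 (Fin (2 * k)) := by
  obtain ⟨a, b, rfl⟩ : ∃ a b, k = 2 * (a + 1) + 3 * (b + 1) := by
    obtain ⟨j, rfl | rfl⟩ := k.even_or_odd'
    · exact ⟨j - 4, 1, by omega⟩
    · exact ⟨j - 2, 0, by omega⟩
  have := numConnected_add_pos (by norm_num)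
    (numConnected_mul_pos (by norm_num) numConnected_three_four_pos a)
    (numConnected_mul_pos (by norm_num) numConnected_three_six_pos b)
  convert this using 3
  ring

theorem numConnected_five_pos (k : ℕ) (hk : 127 ≤ k) : 0 < numConnected 5 (Fin (2 * k)) := by
  obtain ⟨a, b, rfl⟩ : ∃ a b, k = 6 * (a + 1) + 11 * (b + 1) :=
    -- Since `11 * 5 = 55` is 1 modulo 6, taking `b + 1 = 5 * k % 6 + 6` makes `k - 11 * (b + 1)`
    -- divisible by 6. As `b + 1 ≤ 11`, the bound `127 = 11 * 11 + 6` leaves at least one 6.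
    ⟨(k - 11 * (5 * k % 6 + 6)) / 6 - 1, 5 * k % 6 + 5, by omega⟩
  have := numConnected_add_pos (by norm_num)
    (numConnected_mul_pos (by norm_num) numConnected_five_twelve_pos a)
    (numConnected_mul_pos (by norm_num) numConnected_five_twentytwo_pos b)
  convert this using 3
  ring

theorem mainTheorem7 (D : ℕ) (hD : D = 3 ∨ D = 5) :
    ∃ γ : ℝ, 0 < γ ∧
      Tendsto
        (fun n : ℕ =>
          (((boundedDegreePlanarGraphs (2 * n) D D).ncard : ℝ) / ((2 * n)! : ℝ)) ^
            (1 / (2 * n : ℝ)))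
        atTop (𝓝 γ) := by
  have hD1 : 1 ≤ D := by omega
  simp only [ncard_boundedDegreePlanarGraphs hD1]
  rcases hD with rfl | rfl
  · exact exists_tendsto_root_numRegular (by norm_num) (by decide) (n₀ := 8) (by norm_num)
      numConnected_three_pos
  · exact exists_tendsto_root_numRegular (by norm_num) (by decide) (n₀ := 127) (by norm_num)
      numConnected_five_pos
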